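/- **Loss gradient bound.** Let $d,m,L,n\ge 1$ be integers and put $m_0=d$, $m_l=m$ for $l=1,\dots,L$. For a parameter vector $\theta=(\mathrm{vec}(W^{(1)}),\dots,\mathrm{vec}(W^{(L)}),v)\in\mathbb R^p$ with $W^{(l)}\in\mathbb R^{m_l\times m_{l-1}}$ and $v\in\mathbb R^{m}$, consider the network $$\alpha^{(0)}(x)=x,\qquad \alpha^{(l)}(x)=\phi\Big(\tfrac1{\sqrt{m_{l-1}}}W^{(l)}\alpha^{(l-1)}(x)\Big)\ (1\le l\le L),\qquad f(\theta;x)=\tfrac1{\sqrt{m}}\,v^\top\alpha^{(L)}(x),$$ where $\phi:\mathbb R\to\mathbb R$ acts entrywise, is twice differentiable, and satisfies $|\phi'|\le 1$ and $|\phi''|\le\beta_\phi$ for some constant $\beta_\phi$. Let $x_1,\dots,x_n\in\mathbb R^d$ with $\|x_i\|_2^2=d$, let $y_1,\dots,y_n\in\mathbb R$, and let $$\mathcal L(\theta)=\frac1n\sum_{i=1}^n\big(y_i-f(\theta;x_i)\big)^2$$ be the empirical square loss. Let $\sigma_1>0$ and let $\theta_0$ be a random parameter vector with matrices $W^{(l)}_0$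 and last-layer vector $v_0$ such that all entries of $W_0^{(1)},\dots,W_0^{(L)}$ are independent $\mathcal N(0,\sigma_0^2)$ variables with $\sigma_0=\sigma_1\big/\big(2(1+2\sqrt{\log m}/\sqrt m)\big)$, and $v_0$ is a random vector with $\|v_0\|_2=1$ almost surely. For $\rho,\rho_1\ge 0$ let $$B^{\mathrm{spec}}_{\rho,\rho_1}(\theta_0)=\big\{\theta:\ \|W^{(l)}-W^{(l)}_0\|_2\le\rho\ (1\le l\le L),\ \|v-v_0\|_2\le\rho_1\big\},$$ with $\|\cdot\|_2$ the spectral norm on matrices and the Euclidean norm on vectors. Put $\gamma=\sigma_1+\rho/\sqrt m$, $h(l)=\gamma^{l-1}+|\phi(0)|\sum_{i=1}^{l-1}\gamma^{i-1}$, $$\varrho=\Big(h(L+1)^2+\frac1m(1+\rho_1)^2\sum_{l=1}^{L}h(l)^2\gamma^{2(L-l)}\Big)^{1/2},$$ $g(a)=a^L+|\phi(0)|\sum_{i=1}^{L}a^{i-1}$, and $c_{a,b}=\frac2n\sum_{i=1}^ny_i^2+2(1+a)^2|g(b)|^2$. Then, with probability at least $1-\frac{2(L+1)}{m}$ over $\theta_0$,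 for every $\theta\in B^{\mathrm{spec}}_{\rho,\rho_1}(\theta_0)$, $$\|\nabla_\theta\mathcal L(\theta)\|_2\ \le\ 2\sqrt{\mathcal L(\theta)}\,\varrho\ \le\ 2\sqrt{c_{\rho_1,\gamma}}\,\varrho .$$ -/

import Mathlib

open MeasureTheory ProbabilityTheory
open scoped Matrix

noncomputable section

namespace DeepNet

/-! Feed-forward networks of depth `L` with layer widths `w 0, w 1, …, w L`
(`w 0` is the input dimension). -/

/-- Positions of the entries of the weight matrices `W⁽¹⁾, …, W⁽ᴸ⁾`.  The index `l : Fin L`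
stands for the matrix `W⁽ˡ⁺¹⁾`, which has `w (l + 1)` rows and `w l` columns. -/
abbrev WeightIdx (w : ℕ → ℕ) (L : ℕ) : Type :=
  Σ l : Fin L, Fin (w (l + 1)) × Fin (w l)

/-- Coordinates of the parameter vector: all weight entries, then the last-layer vector. -/
abbrev ParamIdx (w : ℕ → ℕ) (L : ℕ) : Type :=
  WeightIdx w L ⊕ Fin (w L)

/-- The parameter space `ℝᵖ`, `p = ∑ₗ mₗ mₗ₋₁ + m_L`, with the Euclidean norm. -/
abbrev Param (w : ℕ → ℕ) (L : ℕ) : Type :=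
  EuclideanSpace ℝ (ParamIdx w L)

/-- The weight matrix `W⁽ˡ⁺¹⁾`. -/
def weight {w : ℕ → ℕ} {L : ℕ} (θ : Param w L) (l : Fin L) :
    Matrix (Fin (w (l + 1))) (Fin (w l)) ℝ :=
  Matrix.of fun i j => θ (Sum.inl ⟨l, (i, j)⟩)

/-- The last-layer vector `v`. -/
def lastVec {w : ℕ → ℕ} {L : ℕ} (θ : Param w L) : EuclideanSpace ℝ (Fin (w L)) :=
  WithLp.toLp 2 fun i => θ (Sum.inr i)

/-- The layer outputs: `α⁽⁰⁾ = x` and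
`α⁽ˡ⁺¹⁾ = φ (m_l ^ (-1/2) • W⁽ˡ⁺¹⁾ α⁽ˡ⁾)`, with `φ` applied entrywise. -/
def layer {w : ℕ → ℕ} {L : ℕ} (φ : ℝ → ℝ) (θ : Param w L) (x : EuclideanSpace ℝ (Fin (w 0))) :
    (l : ℕ) → l ≤ L → EuclideanSpace ℝ (Fin (w l))
  | 0, _ => x
  | l + 1, h =>
      WithLp.toLp 2 fun i =>
        φ (1 / √(w l : ℝ) *
          (weight θ ⟨l, h⟩ *ᵥ (layer φ θ x l (Nat.le_of_succ_le h)).ofLp) i)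

/-- The scalar network output `f(θ; x) = m_L ^ (-1/2) * vᵀ α⁽ᴸ⁾(x)`. -/
def output {w : ℕ → ℕ} {L : ℕ} (φ : ℝ → ℝ) (θ : Param w L)
    (x : EuclideanSpace ℝ (Fin (w 0))) : ℝ :=
  1 / √(w L : ℝ) * ((lastVec θ).ofLp ⬝ᵥ (layer φ θ x L le_rfl).ofLp)

/-- The empirical square loss `(1/n) ∑ᵢ (yᵢ - f(θ; xᵢ))²`. -/
def sqLoss {w : ℕ → ℕ} {L n : ℕ} (φ : ℝ → ℝ) (x : Fin n → EuclideanSpace ℝ (Fin (w 0)))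
    (y : Fin n → ℝ) (θ : Param w L) : ℝ :=
  1 / (n : ℝ) * ∑ i, (y i - output φ θ (x i)) ^ 2

open scoped Matrix.Norms.L2Operator in
/-- The layerwise spectral norm ball: `‖W⁽ˡ⁾ - W̄⁽ˡ⁾‖₂ ≤ ρ` for all layers (the operator norm of
the matrix between Euclidean spaces) and `‖v - v̄‖₂ ≤ ρ₁`. -/
def specBall {w : ℕ → ℕ} {L : ℕ} (ρ ρ₁ : ℝ) (θ' : Param w L) : Set (Param w L) :=
  {θ | (∀ l : Fin L, ‖weight θ l - weight θ' l‖ ≤ ρ) ∧ ‖lastVec θ - lastVec θ'‖ ≤ ρ₁}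

/-- Layer widths `m₀ = d` and `mₗ = m` for `l ≥ 1`. -/
def width (d m : ℕ) : ℕ → ℕ
  | 0 => d
  | _ + 1 => m

/-- The activation is twice differentiable with `|φ'| ≤ 1` and `|φ''| ≤ β`. -/
structure SmoothActivation (φ : ℝ → ℝ) (β : ℝ) : Prop where
  differentiable : Differentiable ℝ φ
  differentiable_deriv : Differentiable ℝ (deriv φ)
  abs_deriv_le : ∀ t, |deriv φ t| ≤ 1
  abs_deriv_deriv_le : ∀ t, |deriv (deriv φ) t| ≤ β

/-- The standard deviation of the initial weights,
`σ₀ = σ₁ / (2 (1 + 2 √(log m) / √m))`. -/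
def initStd (m : ℕ) (σ₁ : ℝ) : ℝ :=
  σ₁ / (2 * (1 + 2 * √(Real.log m) / √(m : ℝ)))

/-- Random initialization: the entries of all weight matrices are independent `N(0, σ₀²)`
variables, and the last-layer vector is a random unit vector. -/
structure IsRandomInit {Ω : Type*} [MeasurableSpace Ω] (μ : Measure Ω) {d m L : ℕ}
    (σ₁ : ℝ) (θ₀ : Ω → Param (width d m) L) : Prop where
  indep : iIndepFun (fun (k : WeightIdx (width d m) L) ω => θ₀ ω (Sum.inl k)) μ
  gaussian : ∀ k : WeightIdx (width d m) L,
    HasLaw (fun ω => θ₀ ω (Sum.inl k)) (gaussianReal 0 (initStd m σ₁ ^ 2).toNNReal) μ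
  aemeasurable_lastVec : AEMeasurable (fun ω => lastVec (θ₀ ω)) μ
  norm_lastVec : ∀ᵐ ω ∂μ, ‖lastVec (θ₀ ω)‖ = 1

/-- `γ = σ₁ + ρ / √m`. -/
def gam (m : ℕ) (σ₁ ρ : ℝ) : ℝ := σ₁ + ρ / √(m : ℝ)

/-- `h(l) = γ ^ (l - 1) + |φ(0)| ∑_{i = 1}^{l - 1} γ ^ (i - 1)`, for `l ≥ 1`. -/
def hFun (φ : ℝ → ℝ) (γ : ℝ) (l : ℕ) : ℝ :=
  γ ^ (l - 1) + |φ 0| * ∑ i ∈ Finset.Icc 1 (l - 1), γ ^ (i - 1)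

/-- The gradient bound `ϱ`, where
`ϱ² = h(L+1)² + (1/m) (1 + ρ₁)² ∑_{l = 1}^{L} h(l)² γ ^ (2 (L - l))`. -/
def rhoBound (φ : ℝ → ℝ) (m L : ℕ) (γ ρ₁ : ℝ) : ℝ :=
  √(hFun φ γ (L + 1) ^ 2 +
    1 / (m : ℝ) * (1 + ρ₁) ^ 2 *
      ∑ l ∈ Finset.Icc 1 L, hFun φ γ l ^ 2 * γ ^ (2 * (L - l)))

/-- `g(a) = a ^ L + |φ(0)| ∑_{i = 1}^{L} a ^ (i - 1)`. -/
def gFun (φ : ℝ → ℝ) (L : ℕ) (a : ℝ) : ℝ :=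
  a ^ L + |φ 0| * ∑ i ∈ Finset.Icc 1 L, a ^ (i - 1)

/-- The loss bound `c_{a,b} = (2/n) ∑ᵢ yᵢ² + 2 (1 + a)² |g(b)|²`. -/
def lossBound {n : ℕ} (φ : ℝ → ℝ) (L : ℕ) (y : Fin n → ℝ) (a b : ℝ) : ℝ :=
  2 / (n : ℝ) * ∑ i, y i ^ 2 + 2 * (1 + a) ^ 2 * |gFun φ L b| ^ 2

end DeepNet

end

/-! The argument is deterministic once the initialization is good. If `‖W‖ / √m ≤ γ` in layers with
input width `m`, then `|φ t| ≤ |t| + |φ 0|` propagates normalized layer norms forward. Since `|φ'| ≤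
1`, the chain rule bounds the derivative of the output by products of layer norms and powers of `γ`.
A perturbation is measured in Frobenius norm, because the squared Frobenius norms add up to the
squared Euclidean norm of the parameter, whereas the weights themselves enter only through operator
norms (`exists_hasFDerivAt_layer`, `exists_hasFDerivAt_output`).

The first matrix is the exception: it is `m × d` with `d` unrelated to `m`, so its operator norm
divided by `√d` need not be of order `γ`. The input does not depend on the parameters, so this norm
never enters the derivative; only the vectors `W⁽¹⁾ xᵢ` matter. A bound for each `i` would cost a
union bound over the arbitrary number `n` of samples. By Cauchy–Schwarz the gradient of the loss
needs only the mean over `i` of the squared derivative bounds (`norm_gradient_sqLoss_le`), so it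
suffices to control the mean of `‖W⁽¹⁾ xᵢ‖²`. Jensen's inequality gives this mean the exponential
moments of a single chi-square variable (`measure_lt_mean_norm_sq_le`), and Minkowski's inequality
carries the mean-square bound through the layers (`mean_layerBound_sq_le`).

For the other matrices, reflections bring a Gaussian matrix to bidiagonal form with entries that are
norms of Gaussian vectors of dimension at most `m`. If all of them are at most `r`, the operator
norm is at most `2 r` (`stdGaussian_not_rowBounded_le`). With `r = √m + 2 √(log m)` each norm fails
with probability at most `1 / m²`, hence each matrix with probability at most `2 / m`; the factor
`2` and this `r` are exactly those in `initStd`. -/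

namespace DeepNet

/-! ### Standard Gaussian vectors: invariance and chi-square tails. -/

section Gaussian

open scoped RealInnerProductSpace ENNReal

/-- A map with a norm-preserving transpose sends standard Gaussians to standard Gaussians. -/
theorem map_stdGaussian_of_adjoint {E F : Type*} [NormedAddCommGroup E] [InnerProductSpace ℝ E]
    [FiniteDimensional ℝ E] [MeasurableSpace E] [BorelSpace E] [NormedAddCommGroup F]
    [InnerProductSpace ℝ F] [FiniteDimensional ℝ F] [MeasurableSpace F] [BorelSpace F]
    {f : E → F} (hf : Measurable f) (P : F → E) (hP : ∀ x t, ⟪f x, t⟫ = ⟪x, P t⟫)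
    (hn : ∀ t, ‖P t‖ ^ 2 = ‖t‖ ^ 2) :
    (stdGaussian E).map f = stdGaussian F := by
  have : IsProbabilityMeasure ((stdGaussian E).map f) :=
    Measure.isProbabilityMeasure_map hf.aemeasurable
  apply Measure.ext_of_charFun
  ext t
  rw [charFun_apply, integral_map hf.aemeasurable
    (Measurable.aestronglyMeasurable (by fun_prop))]
  -- The characteristic function at `t` becomes that of the source at `P t`, which depends only on
  -- `‖P t‖`.
  simp_rw [hP]
  rw [← charFun_apply, charFun_stdGaussian, charFun_stdGaussian]
  congr 2
  exact_mod_cast congrArg Neg.neg (hn t)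

/-- A standard Gaussian is assembled from two independent standard Gaussians. -/
theorem map_prod_stdGaussian_of_adjoint {E F H : Type*}
    [NormedAddCommGroup E] [InnerProductSpace ℝ E]
    [FiniteDimensional ℝ E] [MeasurableSpace E] [BorelSpace E] [NormedAddCommGroup F]
    [InnerProductSpace ℝ F] [FiniteDimensional ℝ F] [MeasurableSpace F] [BorelSpace F]
    [NormedAddCommGroup H]
    [InnerProductSpace ℝ H] [FiniteDimensional ℝ H] [MeasurableSpace H] [BorelSpace H]
    {f : E × F → H} (hf : Measurable f) (P : H → E) (Q : H → F)
    (hPQ : ∀ p t, ⟪f p, t⟫ = ⟪p.1, P t⟫ + ⟪p.2, Q t⟫)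
    (hn : ∀ t, ‖P t‖ ^ 2 + ‖Q t‖ ^ 2 = ‖t‖ ^ 2) :
    ((stdGaussian E).prod (stdGaussian F)).map f = stdGaussian H := by
  have : IsProbabilityMeasure (((stdGaussian E).prod (stdGaussian F)).map f) :=
    Measure.isProbabilityMeasure_map hf.aemeasurable
  apply Measure.ext_of_charFun
  ext t
  rw [charFun_apply, integral_map hf.aemeasurable
    (Measurable.aestronglyMeasurable (by fun_prop))]
  simp_rw [hPQ]
  push_cast
  simp_rw [add_mul, Complex.exp_add]
  rw [integral_prod_mul (fun x : E => Complex.exp (⟪x, P t⟫ * Complex.I))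
    (fun y : F => Complex.exp (⟪y, Q t⟫ * Complex.I)), ← charFun_apply, ← charFun_apply,
    charFun_stdGaussian, charFun_stdGaussian, charFun_stdGaussian, ← Complex.exp_add]
  congr 1
  rw [← Complex.ofReal_pow, ← Complex.ofReal_pow, ← Complex.ofReal_pow, ← hn t]
  push_cast
  ring

/-- A Householder reflection in the hyperplane orthogonal to `v - w`. Being its own adjoint, it can
serve as both map and adjoint in the Gaussian invariance lemma. -/
theorem exists_symmetric_isometry {E : Type*} [NormedAddCommGroup E] [InnerProductSpace ℝ E]
    (v w : E) (h : ‖v‖ = ‖w‖) :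
    ∃ V : E ≃ₗᵢ[ℝ] E, V v = w ∧ ∀ x y, ⟪V x, y⟫ = ⟪x, V y⟫ := by
  refine ⟨(ℝ ∙ (v - w))ᗮ.reflection, Submodule.reflection_sub h, fun x y => ?_⟩
  rw [← LinearIsometryEquiv.inner_map_map (ℝ ∙ (v - w))ᗮ.reflection x
    ((ℝ ∙ (v - w))ᗮ.reflection y), Submodule.reflection_reflection]

theorem inner_eq_sum_mul {ι : Type*} [Fintype ι] (x y : EuclideanSpace ℝ ι) :
    ⟪x, y⟫ = ∑ i, x i * y i := by
  simp [PiLp.inner_apply, mul_comm]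

/-- The factor merges with the density into a Gaussian of rate `1 / 2 - t`, positive by hypothesis.
-/
theorem integrable_and_integral_exp_sq_gaussianReal {t : ℝ} (ht : t < 1 / 2) :
    Integrable (fun x : ℝ => Real.exp (t * x ^ 2)) (gaussianReal 0 1) ∧
      ∫ x, Real.exp (t * x ^ 2) ∂(gaussianReal 0 1) = (√(1 - 2 * t))⁻¹ := by
  have hb : 0 < 1 / 2 - t := by linarith
  have key : ∀ x : ℝ, gaussianPDFReal 0 1 x * Real.exp (t * x ^ 2) =
      (√(2 * Real.pi))⁻¹ * Real.exp (-(1 / 2 - t) * x ^ 2) := by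
    intro x
    simp only [gaussianPDFReal, NNReal.coe_one, mul_one, sub_zero]
    rw [mul_assoc, ← Real.exp_add]
    congr 2
    ring
  constructor
  · rw [gaussianReal_of_var_ne_zero _ one_ne_zero, gaussianPDF_def,
      integrable_withDensity_iff_integrable_smul₀' (by fun_prop) (by simp)]
    simp only [smul_eq_mul, ENNReal.toReal_ofReal (gaussianPDFReal_nonneg _ _ _)]
    simp_rw [key]
    exact (integrable_exp_neg_mul_sq hb).const_mul _
  · rw [integral_gaussianReal_eq_integral_smul one_ne_zero]
    simp only [smul_eq_mul]
    simp_rw [key]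
    rw [integral_const_mul, integral_gaussian, ← Real.sqrt_inv, ← Real.sqrt_inv,
      ← Real.sqrt_mul (by positivity)]
    congr 1
    have : 1 - 2 * t ≠ 0 := by linarith
    have := hb.ne'
    have := Real.pi_ne_zero
    field_simp

theorem lintegral_exp_norm_sq_stdGaussian (k : ℕ) {t : ℝ} (ht : t < 1 / 2) :
    ∫⁻ g, ENNReal.ofReal (Real.exp (t * ‖g‖ ^ 2)) ∂(stdGaussian (EuclideanSpace ℝ (Fin k))) =
      ENNReal.ofReal ((√(1 - 2 * t))⁻¹ ^ k) := by
  obtain ⟨hi, he⟩ := integrable_and_integral_exp_sq_gaussianReal ht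
  rw [← map_pi_eq_stdGaussian, lintegral_map (by fun_prop) (by fun_prop)]
  have h1 : ∀ a : Fin k → ℝ, Real.exp (t * ‖WithLp.toLp 2 a‖ ^ 2) =
      ∏ i, Real.exp (t * a i ^ 2) := by
    intro a
    rw [EuclideanSpace.real_norm_sq_eq, Finset.mul_sum, Real.exp_sum]
  simp_rw [h1]
  rw [← ofReal_integral_eq_lintegral_ofReal (Integrable.fintype_prod fun _ => hi)
    (Filter.Eventually.of_forall fun a => by positivity),
    integral_fintype_prod_eq_prod (f := fun _ x => Real.exp (t * x ^ 2))]
  simp [he]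

/-- The Chernoff exponent for a chi-square variable. -/
theorem chernoff_chi_bound {m : ℕ} (hm : 1 ≤ m) {s r : ℝ} (hs : 0 ≤ s) (hr : r = √m + s) :
    Real.exp (-((1 - m / r ^ 2) / 2 * r ^ 2)) * (√(1 - 2 * ((1 - m / r ^ 2) / 2)))⁻¹ ^ m ≤
      Real.exp (-(s ^ 2 / 2)) := by
  have hm0 : (0 : ℝ) < m := by exact_mod_cast hm
  have hq : 0 < √(m : ℝ) := Real.sqrt_pos.2 hm0
  have hr0 : 0 < r := by rw [hr]; positivity
  have hsq : √(m : ℝ) ^ 2 = m := Real.sq_sqrt hm0.le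
  have h1 : (√(1 - 2 * ((1 - m / r ^ 2) / 2)))⁻¹ = 1 + s / √m := by
    have : 1 - 2 * ((1 - m / r ^ 2) / 2) = (√m / r) ^ 2 := by
      rw [div_pow, hsq]; ring
    rw [this, Real.sqrt_sq (by positivity), inv_div, hr, add_div, div_self hq.ne']
  have h2 : (1 - m / r ^ 2) / 2 * r ^ 2 = (r ^ 2 - m) / 2 := by
    field_simp
  have h3 : (1 + s / √m) ^ m ≤ Real.exp (s * √m) := by
    calc (1 + s / √m) ^ m ≤ Real.exp (s / √m) ^ m := by
          gcongr
          linarith [Real.add_one_le_exp (s / √(m : ℝ))]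
      _ = Real.exp (s * √m) := by
          rw [← Real.exp_nat_mul]
          congr 1
          field_simp
          rw [hsq, mul_comm]
  rw [h1, h2]
  -- With `r = √m + s`, the exponent is `-(2 s √m + s²) / 2 + s √m = -s² / 2`.
  calc _ ≤ Real.exp (-((r ^ 2 - m) / 2)) * Real.exp (s * √m) := by gcongr
    _ = Real.exp (-(s ^ 2 / 2)) := by
      rw [← Real.exp_add, hr]
      congr 1
      nlinarith

/-- Chernoff bound for a quantity whose exponential moments are dominated by those of a chi-square
variable. -/
theorem measure_sq_lt_le_of_lintegral_exp {Ω : Type*} [MeasurableSpace Ω] {μ : Measure Ω}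
    {m : ℕ} (hm : 1 ≤ m) {s r : ℝ} (hs : 0 ≤ s) (hr : r = √m + s) {Q : Ω → ℝ}
    (hQ : AEMeasurable Q μ)
    (h : ∀ t, 0 ≤ t → t < 1 / 2 →
      ∫⁻ ω, ENNReal.ofReal (Real.exp (t * Q ω)) ∂μ ≤ ENNReal.ofReal ((√(1 - 2 * t))⁻¹ ^ m)) :
    μ {ω | r ^ 2 < Q ω} ≤ ENNReal.ofReal (Real.exp (-(s ^ 2 / 2))) := by
  have hm0 : (0 : ℝ) < m := by exact_mod_cast hm
  have hq : 0 < √(m : ℝ) := Real.sqrt_pos.2 hm0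
  have hr0 : 0 < r := by rw [hr]; positivity
  have hsq : √(m : ℝ) ^ 2 = m := Real.sq_sqrt hm0.le
  -- The optimal Chernoff parameter: `1 - 2 t = m / r²` minimizes `exp (-t r²) (1 - 2 t) ^ (-m /
  -- 2)`.
  set t : ℝ := (1 - m / r ^ 2) / 2 with ht
  have hle : (m : ℝ) / r ^ 2 ≤ 1 := by
    rw [div_le_one (by positivity), hr]; nlinarith
  have hpos : 0 < (m : ℝ) / r ^ 2 := by positivity
  have ht0 : 0 ≤ t := by rw [ht]; linarith
  have ht1 : t < 1 / 2 := by rw [ht]; linarith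
  have hc : 0 < Real.exp (t * r ^ 2) := Real.exp_pos _
  calc μ {ω | r ^ 2 < Q ω}
      ≤ μ {ω | ENNReal.ofReal (Real.exp (t * r ^ 2)) ≤ ENNReal.ofReal (Real.exp (t * Q ω))} := by
        apply measure_mono
        intro ω hω
        simp only [Set.mem_ofPred_eq] at hω ⊢
        gcongr
    _ ≤ (∫⁻ ω, ENNReal.ofReal (Real.exp (t * Q ω)) ∂μ) /
          ENNReal.ofReal (Real.exp (t * r ^ 2)) :=
        meas_ge_le_lintegral_div (by fun_prop) (by simpa using hc) ENNReal.ofReal_ne_top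
    _ ≤ ENNReal.ofReal ((√(1 - 2 * t))⁻¹ ^ m) / ENNReal.ofReal (Real.exp (t * r ^ 2)) := by
        gcongr
        exact h t ht0 ht1
    _ = ENNReal.ofReal (Real.exp (-(t * r ^ 2)) * (√(1 - 2 * t))⁻¹ ^ m) := by
        rw [← ENNReal.ofReal_div_of_pos hc, Real.exp_neg]
        congr 1
        field_simp
    _ ≤ _ := ENNReal.ofReal_le_ofReal (chernoff_chi_bound hm hs hr)

/-- For `t ≥ 0` the moment factor is at least `1`, so raising the power from `k` to `m` only weakens
the bound. One threshold thus serves every vector met during bidiagonalization. -/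
theorem stdGaussian_norm_tail {k m : ℕ} (hm : 1 ≤ m) (hk : k ≤ m) {s r : ℝ} (hs : 0 ≤ s)
    (hr : r = √m + s) :
    stdGaussian (EuclideanSpace ℝ (Fin k)) {g | r < ‖g‖} ≤
      ENNReal.ofReal (Real.exp (-(s ^ 2 / 2))) := by
  have hr0 : 0 ≤ r := by rw [hr]; positivity
  have : {g : EuclideanSpace ℝ (Fin k) | r < ‖g‖} = {g | r ^ 2 < ‖g‖ ^ 2} := by
    ext g
    simp only [Set.mem_ofPred_eq]
    rw [sq_lt_sq₀ hr0 (norm_nonneg _)]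
  rw [this]
  refine measure_sq_lt_le_of_lintegral_exp hm hs hr (by fun_prop) fun t ht0 ht1 => ?_
  rw [lintegral_exp_norm_sq_stdGaussian k ht1]
  apply ENNReal.ofReal_le_ofReal
  refine pow_le_pow_right₀ ?_ hk
  rw [one_le_inv₀ (Real.sqrt_pos.2 (by linarith))]
  exact Real.sqrt_le_one.2 (by linarith)

end Gaussian

/-! ### Operator norm of a Gaussian matrix by bidiagonalization. -/

section GaussianMatrix

open scoped RealInnerProductSpace ENNReal

/-- The `i`-th row of a matrix given as a Euclidean vector. -/
def rowVec {a b : ℕ} (G : EuclideanSpace ℝ (Fin a × Fin b)) (i : Fin a) :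
    EuclideanSpace ℝ (Fin b) :=
  WithLp.toLp 2 fun j => G (i, j)

/-- The `j`-th column of a matrix given as a Euclidean vector. -/
def colVec {a b : ℕ} (G : EuclideanSpace ℝ (Fin a × Fin b)) (j : Fin b) :
    EuclideanSpace ℝ (Fin a) :=
  WithLp.toLp 2 fun i => G (i, j)

@[simp] theorem rowVec_apply {a b : ℕ} (G : EuclideanSpace ℝ (Fin a × Fin b)) (i : Fin a)
    (j : Fin b) : rowVec G i j = G (i, j) := rfl

@[simp] theorem colVec_apply {a b : ℕ} (G : EuclideanSpace ℝ (Fin a × Fin b)) (i : Fin a)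
    (j : Fin b) : colVec G j i = G (i, j) := rfl

theorem continuous_rowVec {a b : ℕ} (i : Fin a) :
    Continuous fun G : EuclideanSpace ℝ (Fin a × Fin b) => rowVec G i := by
  unfold rowVec; fun_prop

theorem continuous_colVec {a b : ℕ} (j : Fin b) :
    Continuous fun G : EuclideanSpace ℝ (Fin a × Fin b) => colVec G j := by
  unfold colVec; fun_prop

theorem inner_eq_sum_rowVec {a b : ℕ} (G H : EuclideanSpace ℝ (Fin a × Fin b)) :
    ⟪G, H⟫ = ∑ i, ⟪rowVec G i, rowVec H i⟫ := by
  simp only [inner_eq_sum_mul, Fintype.sum_prod_type, rowVec_apply]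

theorem inner_eq_sum_colVec {a b : ℕ} (G H : EuclideanSpace ℝ (Fin a × Fin b)) :
    ⟪G, H⟫ = ∑ j, ⟪colVec G j, colVec H j⟫ := by
  simp only [inner_eq_sum_mul, Fintype.sum_prod_type_right, colVec_apply]

theorem norm_sq_eq_sum_rowVec {a b : ℕ} (G : EuclideanSpace ℝ (Fin a × Fin b)) :
    ‖G‖ ^ 2 = ∑ i, ‖rowVec G i‖ ^ 2 := by
  simp only [← real_inner_self_eq_norm_sq, inner_eq_sum_rowVec G]

theorem norm_sq_eq_sum_colVec {a b : ℕ} (G : EuclideanSpace ℝ (Fin a × Fin b)) :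
    ‖G‖ ^ 2 = ∑ j, ‖colVec G j‖ ^ 2 := by
  simp only [← real_inner_self_eq_norm_sq, inner_eq_sum_colVec G]

/-- Both sides are `‖G x‖²`. The column form makes invariance under isometries acting on columns
visible. -/
theorem sum_inner_rowVec_sq {a b : ℕ} (G : EuclideanSpace ℝ (Fin a × Fin b))
    (x : EuclideanSpace ℝ (Fin b)) :
    ∑ i, ⟪rowVec G i, x⟫ ^ 2 = ‖∑ j, x j • colVec G j‖ ^ 2 := by
  rw [EuclideanSpace.real_norm_sq_eq]
  refine Finset.sum_congr rfl fun i _ => ?_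
  simp [inner_eq_sum_mul, mul_comm]

/-- `V` applied to each row. -/
noncomputable def mapRows {a b : ℕ} (V : EuclideanSpace ℝ (Fin b) ≃ₗᵢ[ℝ] EuclideanSpace ℝ (Fin b))
    (G : EuclideanSpace ℝ (Fin a × Fin b)) : EuclideanSpace ℝ (Fin a × Fin b) :=
  WithLp.toLp 2 fun p => V (rowVec G p.1) p.2

/-- `U` applied to each column. -/
noncomputable def mapCols {a b : ℕ} (U : EuclideanSpace ℝ (Fin a) ≃ₗᵢ[ℝ] EuclideanSpace ℝ (Fin a))
    (G : EuclideanSpace ℝ (Fin a × Fin b)) : EuclideanSpace ℝ (Fin a × Fin b) :=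
  WithLp.toLp 2 fun p => U (colVec G p.2) p.1

@[simp] theorem rowVec_mapRows {a b : ℕ}
    (V : EuclideanSpace ℝ (Fin b) ≃ₗᵢ[ℝ] EuclideanSpace ℝ (Fin b))
    (G : EuclideanSpace ℝ (Fin a × Fin b)) (i : Fin a) :
    rowVec (mapRows V G) i = V (rowVec G i) := rfl

@[simp] theorem colVec_mapCols {a b : ℕ}
    (U : EuclideanSpace ℝ (Fin a) ≃ₗᵢ[ℝ] EuclideanSpace ℝ (Fin a))
    (G : EuclideanSpace ℝ (Fin a × Fin b)) (j : Fin b) :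
    colVec (mapCols U G) j = U (colVec G j) := rfl

theorem measurable_mapRows {a b : ℕ}
    (V : EuclideanSpace ℝ (Fin b) ≃ₗᵢ[ℝ] EuclideanSpace ℝ (Fin b)) :
    Measurable (mapRows V : EuclideanSpace ℝ (Fin a × Fin b) → _) := by
  apply Continuous.measurable
  unfold mapRows
  refine (PiLp.continuous_toLp 2 _).comp (continuous_pi fun p => ?_)
  exact (EuclideanSpace.proj p.2).continuous.comp (V.continuous.comp (continuous_rowVec p.1))

theorem measurable_mapCols {a b : ℕ}
    (U : EuclideanSpace ℝ (Fin a) ≃ₗᵢ[ℝ] EuclideanSpace ℝ (Fin a)) :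
    Measurable (mapCols U : EuclideanSpace ℝ (Fin a × Fin b) → _) := by
  apply Continuous.measurable
  unfold mapCols
  refine (PiLp.continuous_toLp 2 _).comp (continuous_pi fun p => ?_)
  exact (EuclideanSpace.proj p.1).continuous.comp (U.continuous.comp (continuous_colVec p.2))

theorem map_mapRows_stdGaussian {a b : ℕ}
    (V : EuclideanSpace ℝ (Fin b) ≃ₗᵢ[ℝ] EuclideanSpace ℝ (Fin b))
    (hV : ∀ x y, ⟪V x, y⟫ = ⟪x, V y⟫) :
    (stdGaussian (EuclideanSpace ℝ (Fin a × Fin b))).map (mapRows V) = stdGaussian _ :=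
  map_stdGaussian_of_adjoint (measurable_mapRows V) (mapRows V)
    (fun x t => by simp [inner_eq_sum_rowVec, hV]) (fun t => by simp [norm_sq_eq_sum_rowVec])

theorem map_mapCols_stdGaussian {a b : ℕ}
    (U : EuclideanSpace ℝ (Fin a) ≃ₗᵢ[ℝ] EuclideanSpace ℝ (Fin a))
    (hU : ∀ x y, ⟪U x, y⟫ = ⟪x, U y⟫) :
    (stdGaussian (EuclideanSpace ℝ (Fin a × Fin b))).map (mapCols U) = stdGaussian _ :=
  map_stdGaussian_of_adjoint (measurable_mapCols U) (mapCols U)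
    (fun x t => by simp [inner_eq_sum_colVec, hU]) (fun t => by simp [norm_sq_eq_sum_colVec])

/-- The matrix with first column `p.1` and remaining columns `p.2`. -/
def consCol {a b : ℕ} (p : EuclideanSpace ℝ (Fin a) × EuclideanSpace ℝ (Fin a × Fin b)) :
    EuclideanSpace ℝ (Fin a × Fin (b + 1)) :=
  WithLp.toLp 2 fun q => Fin.cases (p.1 q.1) (fun j => p.2 (q.1, j)) q.2

/-- The matrix with first row `p.1` and remaining rows `p.2`. -/
def consRow {a b : ℕ} (p : EuclideanSpace ℝ (Fin b) × EuclideanSpace ℝ (Fin a × Fin b)) :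
    EuclideanSpace ℝ (Fin (a + 1) × Fin b) :=
  WithLp.toLp 2 fun q => Fin.cases (p.1 q.2) (fun i => p.2 (i, q.2)) q.1

section

variable {a b : ℕ}

@[simp] theorem consCol_zero (p : EuclideanSpace ℝ (Fin a) × EuclideanSpace ℝ (Fin a × Fin b))
    (i : Fin a) : consCol p (i, 0) = p.1 i := rfl

@[simp] theorem consCol_succ (p : EuclideanSpace ℝ (Fin a) × EuclideanSpace ℝ (Fin a × Fin b))
    (i : Fin a) (j : Fin b) : consCol p (i, j.succ) = p.2 (i, j) := rfl

@[simp] theorem consRow_zero (p : EuclideanSpace ℝ (Fin b) × EuclideanSpace ℝ (Fin a × Fin b))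
    (j : Fin b) : consRow p (0, j) = p.1 j := rfl

@[simp] theorem consRow_succ (p : EuclideanSpace ℝ (Fin b) × EuclideanSpace ℝ (Fin a × Fin b))
    (i : Fin a) (j : Fin b) : consRow p (i.succ, j) = p.2 (i, j) := rfl

theorem measurable_consCol :
    Measurable (consCol : EuclideanSpace ℝ (Fin a) × EuclideanSpace ℝ (Fin a × Fin b) → _) := by
  apply Continuous.measurable
  refine (PiLp.continuous_toLp 2 _).comp (continuous_pi fun q => ?_)
  obtain ⟨i, j⟩ := q
  cases j using Fin.cases <;> simp <;> fun_prop

theorem measurable_consRow :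
    Measurable (consRow : EuclideanSpace ℝ (Fin b) × EuclideanSpace ℝ (Fin a × Fin b) → _) := by
  apply Continuous.measurable
  refine (PiLp.continuous_toLp 2 _).comp (continuous_pi fun q => ?_)
  obtain ⟨i, j⟩ := q
  cases i using Fin.cases <;> simp <;> fun_prop

theorem map_consCol_stdGaussian :
    ((stdGaussian (EuclideanSpace ℝ (Fin a))).prod
      (stdGaussian (EuclideanSpace ℝ (Fin a × Fin b)))).map consCol = stdGaussian _ := by
  refine map_prod_stdGaussian_of_adjoint measurable_consCol (fun t => colVec t 0)
    (fun t => WithLp.toLp 2 fun q => t (q.1, q.2.succ)) (fun p t => ?_) (fun t => ?_)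
  · simp only [inner_eq_sum_mul, Fintype.sum_prod_type_right, Fin.sum_univ_succ, consCol_zero,
      consCol_succ, colVec_apply]
  · simp only [EuclideanSpace.real_norm_sq_eq, Fintype.sum_prod_type_right, Fin.sum_univ_succ,
      colVec_apply]

theorem map_consRow_stdGaussian :
    ((stdGaussian (EuclideanSpace ℝ (Fin b))).prod
      (stdGaussian (EuclideanSpace ℝ (Fin a × Fin b)))).map consRow = stdGaussian _ := by
  refine map_prod_stdGaussian_of_adjoint measurable_consRow (fun t => rowVec t 0)
    (fun t => WithLp.toLp 2 fun q => t (q.1.succ, q.2)) (fun p t => ?_) (fun t => ?_)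
  · simp only [inner_eq_sum_mul, Fintype.sum_prod_type, Fin.sum_univ_succ, consRow_zero,
      consRow_succ, rowVec_apply]
  · simp only [EuclideanSpace.real_norm_sq_eq, Fintype.sum_prod_type, Fin.sum_univ_succ,
      rowVec_apply]

/-- The matrix `G`, with the extra row `c` counted twice, has operator norm at most `2 r`. -/
def RowBounded (r : ℝ) (c : EuclideanSpace ℝ (Fin b)) (G : EuclideanSpace ℝ (Fin a × Fin b)) :
    Prop :=
  ∀ x : EuclideanSpace ℝ (Fin b),
    ∑ i, ⟪rowVec G i, x⟫ ^ 2 + 2 * ⟪c, x⟫ ^ 2 ≤ 4 * r ^ 2 * ‖x‖ ^ 2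

theorem measurableSet_not_rowBounded (r : ℝ) (c : EuclideanSpace ℝ (Fin b)) :
    MeasurableSet {G : EuclideanSpace ℝ (Fin a × Fin b) | ¬ RowBounded r c G} := by
  have h : IsClosed {G : EuclideanSpace ℝ (Fin a × Fin b) | RowBounded r c G} := by
    simp only [RowBounded, Set.ofPred_forall]
    refine isClosed_iInter fun x => isClosed_le ?_ continuous_const
    refine Continuous.add (continuous_finsetSum _ fun i _ => ?_) continuous_const
    exact ((continuous_rowVec i).inner continuous_const).pow 2
  exact h.measurableSet.compl

theorem rowBounded_mapRows_iff {r : ℝ} {c : EuclideanSpace ℝ (Fin b)}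
    {G : EuclideanSpace ℝ (Fin a × Fin b)}
    (V : EuclideanSpace ℝ (Fin b) ≃ₗᵢ[ℝ] EuclideanSpace ℝ (Fin b)) :
    RowBounded r (V c) (mapRows V G) ↔ RowBounded r c G := by
  refine V.toEquiv.forall_congr_right.symm.trans (forall_congr' fun x => ?_)
  simp

theorem rowBounded_mapCols_iff {r : ℝ} {c : EuclideanSpace ℝ (Fin b)}
    {G : EuclideanSpace ℝ (Fin a × Fin b)}
    (U : EuclideanSpace ℝ (Fin a) ≃ₗᵢ[ℝ] EuclideanSpace ℝ (Fin a)) :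
    RowBounded r c (mapCols U G) ↔ RowBounded r c G := by
  unfold RowBounded
  have h : ∀ x : EuclideanSpace ℝ (Fin b), ∑ j, x j • U (colVec G j) =
      U (∑ j, x j • colVec G j) := by simp
  simp only [sum_inner_rowVec_sq, colVec_mapCols, h, U.norm_map]

theorem mapCols_consCol (U : EuclideanSpace ℝ (Fin a) ≃ₗᵢ[ℝ] EuclideanSpace ℝ (Fin a))
    (p : EuclideanSpace ℝ (Fin a) × EuclideanSpace ℝ (Fin a × Fin b)) :
    mapCols U (consCol p) = consCol (U p.1, mapCols U p.2) := by
  ext ⟨i, j⟩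
  cases j using Fin.cases <;> rfl

/-- The first row contributes `(t x₀ + ⟪w, x'⟫)² ≤ 2 t² x₀² + 2 ⟪w, x'⟫²`. The second term is the
doubled extra row of the smaller block, which explains the weight `2` in `RowBounded`; the first,
together with `2 s² x₀²`, is at most `4 r² x₀²`. -/
theorem rowBounded_consCol_consRow {r s t : ℝ} (hs0 : 0 ≤ s) (hs : s ≤ r) (ht0 : 0 ≤ t)
    (ht : t ≤ r) {w : EuclideanSpace ℝ (Fin b)} {G : EuclideanSpace ℝ (Fin a × Fin b)}
    (h : RowBounded r w G) :
    RowBounded r (EuclideanSpace.single 0 s)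
      (consCol (EuclideanSpace.single 0 t, consRow (w, G))) := by
  intro x
  have hx := h (WithLp.toLp 2 fun j => x j.succ)
  simp only [inner_eq_sum_mul, EuclideanSpace.real_norm_sq_eq, Fin.sum_univ_succ, rowVec_apply,
    consCol_zero, consCol_succ, consRow_zero, consRow_succ, PiLp.single_apply] at hx ⊢
  simp only [if_true, Fin.succ_ne_zero, if_false, zero_mul, zero_add, Finset.sum_const_zero,
    add_zero] at hx ⊢
  have h1 : s ^ 2 ≤ r ^ 2 := by gcongr
  have h2 : t ^ 2 ≤ r ^ 2 := by gcongr
  nlinarith [sq_nonneg (t * x 0 - ∑ j, w j * x j.succ), sq_nonneg (x 0),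
    mul_le_mul_of_nonneg_right h1 (sq_nonneg (x 0)),
    mul_le_mul_of_nonneg_right h2 (sq_nonneg (x 0))]

end

/-- Conditioning on the first factor: pay `ε` for its bad values and bound the fibre over each
remaining one. -/
theorem prod_apply_le_add {α β : Type*} [MeasurableSpace α] [MeasurableSpace β] {μ : Measure α}
    {ν : Measure β} [IsProbabilityMeasure μ] [IsProbabilityMeasure ν] {S : Set (α × β)}
    (hS : MeasurableSet S) {A : Set α} (hA : MeasurableSet A) {ε K : ℝ≥0∞} (hε : μ A ≤ ε)
    (h : ∀ x ∉ A, ν (Prod.mk x ⁻¹' S) ≤ K) : μ.prod ν S ≤ ε + K := by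
  rw [Measure.prod_apply hS]
  calc ∫⁻ x, ν (Prod.mk x ⁻¹' S) ∂μ ≤ ∫⁻ x, (A.indicator 1 x + K) ∂μ := by
        refine lintegral_mono fun x => ?_
        by_cases hx : x ∈ A
        · simp only [Set.indicator_of_mem hx, Pi.one_apply]
          exact prob_le_one.trans le_self_add
        · simp only [Set.indicator_of_notMem hx, zero_add]
          exact h x hx
    _ = μ A + K := by
        rw [lintegral_add_right _ measurable_const, lintegral_indicator_one hA]
        simp
    _ ≤ ε + K := by gcongr

/-- Operator norm tail for Gaussian matrices, by successive bidiagonalization. -/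
theorem stdGaussian_not_rowBounded_le {m : ℕ} {r : ℝ} {ε : ℝ≥0∞}
    (hε : ∀ k ≤ m, stdGaussian (EuclideanSpace ℝ (Fin k)) {g | r < ‖g‖} ≤ ε) (b : ℕ) :
    ∀ a, a ≤ m → b ≤ m → ∀ c : EuclideanSpace ℝ (Fin b), ‖c‖ ≤ r →
      stdGaussian (EuclideanSpace ℝ (Fin a × Fin b)) {G | ¬ RowBounded r c G} ≤
        (2 * b : ℕ) * ε := by
  induction b with
  | zero =>
    intro a _ _ c _
    have : {G : EuclideanSpace ℝ (Fin a × Fin 0) | ¬ RowBounded r c G} = ∅ := by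
      ext G
      simp only [RowBounded, inner_eq_sum_mul, Set.mem_ofPred_eq, Set.mem_empty_iff_false, iff_false,
        not_not]
      intro x
      simp only [Finset.univ_eq_empty, Finset.sum_empty]
      norm_num
      positivity
    simp [this]
  | succ b ih =>
    intro a ha hb c hc
    cases a with
    | zero =>
      have : {G : EuclideanSpace ℝ (Fin 0 × Fin (b + 1)) | ¬ RowBounded r c G} = ∅ := by
        rw [Set.eq_empty_iff_forall_notMem]
        intro G hG
        refine hG fun x => ?_
        have h1 : ⟪c, x⟫ ^ 2 ≤ (‖c‖ * ‖x‖) ^ 2 := sq_le_sq' (by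
          linarith [neg_abs_le ⟪c, x⟫, abs_real_inner_le_norm c x]) (real_inner_le_norm c x)
        have h2 : (‖c‖ * ‖x‖) ^ 2 ≤ (r * ‖x‖) ^ 2 := by gcongr
        simp only [Finset.univ_eq_empty, Finset.sum_empty, zero_add]
        nlinarith [sq_nonneg (r * ‖x‖)]
      simp [this]
    | succ a =>
      -- Rotating the row space puts the extra row `c` on the first axis without changing the law of
      -- the matrix.
      obtain ⟨V, hV, hVs⟩ := exists_symmetric_isometry c (EuclideanSpace.single 0 ‖c‖) (by simp)
      have hset : {G : EuclideanSpace ℝ (Fin (a + 1) × Fin (b + 1)) | ¬ RowBounded r c G} =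
          mapRows V ⁻¹' {G | ¬ RowBounded r (EuclideanSpace.single 0 ‖c‖) G} := by
        ext G
        rw [Set.mem_preimage, Set.mem_ofPred_eq, Set.mem_ofPred_eq, ← hV, rowBounded_mapRows_iff]
      have hms := measurableSet_not_rowBounded (a := a + 1) r
        (EuclideanSpace.single (0 : Fin (b + 1)) ‖c‖)
      rw [hset, ← Measure.map_apply (measurable_mapRows V) hms, map_mapRows_stdGaussian V hVs,
        ← map_consCol_stdGaussian, Measure.map_apply measurable_consCol hms]
      have hnm : ∀ k : ℕ, MeasurableSet {g : EuclideanSpace ℝ (Fin k) | r < ‖g‖} := fun k =>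
        (isOpen_lt continuous_const continuous_norm).measurableSet
      -- Each column peeled off costs two events: its own norm, and the norm of what remains of the
      -- first row.
      have hsum : ((2 * (b + 1) : ℕ) : ℝ≥0∞) * ε = ε + (ε + (2 * b : ℕ) * ε) := by
        push_cast; ring
      rw [hsum]
      refine prod_apply_le_add (measurable_consCol hms) (hnm _) (hε _ ha) fun g hg => ?_
      simp only [Set.mem_ofPred_eq, not_lt] at hg
      -- `U` depends on the first column `g`, but `g` is now fixed and the other columns are
      -- independent of it, so `U` preserves their law.
      obtain ⟨U, hU, hUs⟩ := exists_symmetric_isometry g (EuclideanSpace.single 0 ‖g‖) (by simp)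
      have hset2 : Prod.mk g ⁻¹' (consCol ⁻¹'
            {G | ¬ RowBounded r (EuclideanSpace.single (0 : Fin (b + 1)) ‖c‖) G}) =
          mapCols U ⁻¹' (Prod.mk (EuclideanSpace.single 0 ‖g‖) ⁻¹' (consCol ⁻¹'
            {G | ¬ RowBounded r (EuclideanSpace.single (0 : Fin (b + 1)) ‖c‖) G})) := by
        ext G
        simp only [Set.mem_preimage, Set.mem_ofPred_eq]
        rw [← hU, ← mapCols_consCol U (g, G), rowBounded_mapCols_iff]
      have hms2 : MeasurableSet (Prod.mk (EuclideanSpace.single (0 : Fin (a + 1)) ‖g‖) ⁻¹'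
          (consCol ⁻¹'
            {G | ¬ RowBounded r (EuclideanSpace.single (0 : Fin (b + 1)) ‖c‖) G})) :=
        measurable_prodMk_left (measurable_consCol hms)
      rw [hset2, ← Measure.map_apply (measurable_mapCols U) hms2, map_mapCols_stdGaussian U hUs,
        ← map_consRow_stdGaussian, Measure.map_apply measurable_consRow hms2]
      refine prod_apply_le_add (measurable_consRow hms2) (hnm _) (hε _ (by omega)) fun w hw => ?_
      -- The remaining first row `w` becomes the extra row in the induction hypothesis, which is why
      -- `c` is universally quantified there.
      simp only [Set.mem_ofPred_eq, not_lt] at hw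
      refine (measure_mono ?_).trans (ih a (by omega) (by omega) w hw)
      intro G hG hbd
      exact hG (rowBounded_consCol_consRow (norm_nonneg c) hc (norm_nonneg g) hg hbd)

end GaussianMatrix

/-! ### Tail bounds for random weight matrices. -/

section GaussianWeights

open scoped RealInnerProductSpace ENNReal Matrix.Norms.L2Operator

/-- Independent centred Gaussian entries, divided by their standard deviation, form a standard
Gaussian vector. -/
theorem hasLaw_stdGaussian_of_iIndepFun {Ω ι : Type*} [MeasurableSpace Ω] [Fintype ι]
    {μ : Measure Ω} [IsProbabilityMeasure μ] {σ : ℝ} (hσ : 0 < σ) {X : ι → Ω → ℝ}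
    (hX : iIndepFun X μ) (hlaw : ∀ k, HasLaw (X k) (gaussianReal 0 (σ ^ 2).toNNReal) μ) :
    HasLaw (fun ω => WithLp.toLp 2 fun k => X k ω / σ) (stdGaussian (EuclideanSpace ℝ ι)) μ := by
  have hY : ∀ k, HasLaw (fun ω => X k ω / σ) (gaussianReal 0 1) μ := by
    intro k
    have h := gaussianReal_const_mul (hlaw k) σ⁻¹
    have hv : NNReal.mk (σ⁻¹ ^ 2) (sq_nonneg _) * (σ ^ 2).toNNReal = 1 := by
      ext
      simp only [NNReal.coe_mul, NNReal.coe_mk, Real.coe_toNNReal _ (sq_nonneg σ), NNReal.coe_one]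
      field_simp
    rw [mul_zero, hv] at h
    exact h.congr (Filter.Eventually.of_forall fun ω => div_eq_inv_mul _ _)
  have hind : iIndepFun (fun k ω => X k ω / σ) μ :=
    hX.comp (fun _ x => x / σ) fun _ => by fun_prop
  have hstd : HasLaw (WithLp.toLp 2) (stdGaussian (EuclideanSpace ℝ ι))
      (Measure.pi fun _ : ι => gaussianReal 0 1) := ⟨by fun_prop, map_pi_eq_stdGaussian⟩
  exact hstd.comp (hind.hasLaw_pi hY)

theorem exp_neg_two_sqrt_log_sq {m : ℕ} (hm : 1 ≤ m) :
    Real.exp (-((2 * √(Real.log m)) ^ 2 / 2)) = 1 / (m : ℝ) ^ 2 := by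
  have hm0 : (0 : ℝ) < m := by exact_mod_cast hm
  have : -((2 * √(Real.log m)) ^ 2 / 2) = -(Real.log ((m : ℝ) ^ 2)) := by
    rw [mul_pow, Real.sq_sqrt (Real.log_nonneg (by exact_mod_cast hm)), Real.log_pow]
    push_cast; ring
  rw [this, Real.exp_neg, Real.exp_log (by positivity), one_div]

theorem opNorm_le_of_rowBounded {a b : ℕ} {r : ℝ} (hr : 0 ≤ r)
    {G : EuclideanSpace ℝ (Fin a × Fin b)} (h : RowBounded r 0 G) :
    ‖(Matrix.of fun i j => G (i, j) : Matrix (Fin a) (Fin b) ℝ)‖ ≤ 2 * r := by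
  rw [Matrix.l2_opNorm_def]
  refine ContinuousLinearMap.opNorm_le_bound _ (by positivity) fun x => ?_
  rw [← sq_le_sq₀ (norm_nonneg _) (by positivity), EuclideanSpace.real_norm_sq_eq]
  have := h x
  simp only [inner_eq_sum_mul, rowVec_apply, PiLp.zero_apply, zero_mul, Finset.sum_const_zero] at this
  convert! this using 1
  · rw [zero_pow two_ne_zero, mul_zero, add_zero]
    rfl
  · ring

/-- Operator norm tail for matrices with independent centred Gaussian entries. -/
theorem measure_lt_opNorm_le {Ω : Type*} [MeasurableSpace Ω] {μ : Measure Ω}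
    [IsProbabilityMeasure μ] {a b m : ℕ} (hm : 1 ≤ m) (ha : a ≤ m) (hb : b ≤ m) {σ : ℝ}
    (hσ : 0 < σ) {X : Fin a × Fin b → Ω → ℝ} (hX : iIndepFun X μ)
    (hlaw : ∀ k, HasLaw (X k) (gaussianReal 0 (σ ^ 2).toNNReal) μ) :
    μ {ω | σ * (2 * (√m + 2 * √(Real.log m))) <
        ‖(Matrix.of fun i j => X (i, j) ω : Matrix (Fin a) (Fin b) ℝ)‖} ≤
      ENNReal.ofReal (2 / m) := by
  have hm0 : (0 : ℝ) < m := by exact_mod_cast hm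
  have hlawG := hasLaw_stdGaussian_of_iIndepFun hσ hX hlaw
  set r : ℝ := √m + 2 * √(Real.log m) with hr
  have hr0 : 0 ≤ r := by positivity
  have key := stdGaussian_not_rowBounded_le (m := m) (r := r)
    (fun k hk => stdGaussian_norm_tail hm hk (by positivity) hr) b a ha hb 0 (by simpa using hr0)
  rw [← hlawG.map_eq, Measure.map_apply_of_aemeasurable hlawG.aemeasurable
    (measurableSet_not_rowBounded _ _)] at key
  refine (measure_mono ?_).trans (key.trans ?_)
  · intro ω hω hb'
    have h1 := opNorm_le_of_rowBounded hr0 hb'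
    have h2 : (Matrix.of fun i j => X (i, j) ω : Matrix (Fin a) (Fin b) ℝ) =
        σ • Matrix.of fun i j => X (i, j) ω / σ := by
      ext i j
      simp only [Matrix.of_apply, Matrix.smul_apply, smul_eq_mul]
      field_simp
    simp only [Set.mem_ofPred_eq] at hω
    rw [h2, norm_smul, Real.norm_of_nonneg hσ.le] at hω
    exact absurd (lt_of_mul_lt_mul_left hω hσ.le) (not_lt.2 h1)
  -- There are `2 b` events of probability at most `1 / m²`, and `b ≤ m`.
  · rw [exp_neg_two_sqrt_log_sq hm, ← ENNReal.ofReal_natCast, ← ENNReal.ofReal_mul (by positivity)]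
    apply ENNReal.ofReal_le_ofReal
    have hb1 : (b : ℝ) ≤ m := by exact_mod_cast hb
    push_cast
    rw [mul_one_div, div_le_div_iff₀ (by positivity) hm0]
    nlinarith

/-- The adjoint sends `t` to the rank-one matrix `t uᵀ`, whose Frobenius norm is `‖t‖` because `u`
is a unit vector. -/
theorem map_rowVec_inner_stdGaussian {a b : ℕ} {u : EuclideanSpace ℝ (Fin b)} (hu : ‖u‖ = 1) :
    (stdGaussian (EuclideanSpace ℝ (Fin a × Fin b))).map
      (fun G => WithLp.toLp 2 fun i => ⟪rowVec G i, u⟫) = stdGaussian _ := by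
  have hc : Continuous fun G : EuclideanSpace ℝ (Fin a × Fin b) =>
      (WithLp.toLp 2 fun i => ⟪rowVec G i, u⟫ : EuclideanSpace ℝ (Fin a)) :=
    (PiLp.continuous_toLp 2 _).comp (continuous_pi fun i =>
      (continuous_rowVec i).inner continuous_const)
  refine map_stdGaussian_of_adjoint hc.measurable
    (fun t => WithLp.toLp 2 fun p => t p.1 * u p.2) (fun G t => ?_) (fun t => ?_)
  · simp only [inner_eq_sum_mul, Fintype.sum_prod_type, rowVec_apply, Finset.sum_mul]
    exact Finset.sum_congr rfl fun i _ => Finset.sum_congr rfl fun j _ => by ring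
  · have h1 : ∑ j, u j ^ 2 = 1 := by rw [← EuclideanSpace.real_norm_sq_eq, hu, one_pow]
    simp only [EuclideanSpace.real_norm_sq_eq, Fintype.sum_prod_type, mul_pow, ← Finset.mul_sum, h1,
      mul_one]

/-- Tail of the mean squared length of the images of unit vectors under a Gaussian matrix. -/
theorem measure_lt_mean_norm_sq_le {Ω : Type*} [MeasurableSpace Ω] {μ : Measure Ω}
    [IsProbabilityMeasure μ] {m d n : ℕ} (hm : 1 ≤ m) (hn : 1 ≤ n) {σ : ℝ}
    (hσ : 0 < σ) {X : Fin m × Fin d → Ω → ℝ} (hX : iIndepFun X μ)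
    (hlaw : ∀ k, HasLaw (X k) (gaussianReal 0 (σ ^ 2).toNNReal) μ)
    {u : Fin n → EuclideanSpace ℝ (Fin d)} (hu : ∀ i, ‖u i‖ = 1) :
    μ {ω | (σ * (√m + 2 * √(Real.log m))) ^ 2 <
        1 / (n : ℝ) * ∑ i, ∑ k, ((Matrix.of fun i j => X (i, j) ω) *ᵥ (u i).ofLp) k ^ 2} ≤
      ENNReal.ofReal (1 / m ^ 2) := by
  have hn0 : (0 : ℝ) < n := by exact_mod_cast hn
  have hlawG := hasLaw_stdGaussian_of_iIndepFun hσ hX hlaw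
  set r : ℝ := √m + 2 * √(Real.log m) with hr
  set Y : Fin n → EuclideanSpace ℝ (Fin m × Fin d) → EuclideanSpace ℝ (Fin m) :=
    fun i G => WithLp.toLp 2 fun k => ⟪rowVec G k, u i⟫ with hY
  have hYm : ∀ i, Measurable (Y i) := fun i => Continuous.measurable <|
    (PiLp.continuous_toLp 2 _).comp (continuous_pi fun k =>
      (continuous_rowVec k).inner continuous_const)
  have key : stdGaussian (EuclideanSpace ℝ (Fin m × Fin d))
      {G | r ^ 2 < ∑ i, 1 / (n : ℝ) * ‖Y i G‖ ^ 2} ≤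
        ENNReal.ofReal (Real.exp (-((2 * √(Real.log m)) ^ 2 / 2))) := by
    refine measure_sq_lt_le_of_lintegral_exp hm (by positivity) hr (by fun_prop)
      fun t ht0 ht1 => ?_
    calc ∫⁻ G, ENNReal.ofReal (Real.exp (t * ∑ i, 1 / (n : ℝ) * ‖Y i G‖ ^ 2))
          ∂(stdGaussian (EuclideanSpace ℝ (Fin m × Fin d)))
        ≤ ∫⁻ G, ∑ i, ENNReal.ofReal (1 / n) * ENNReal.ofReal (Real.exp (t * ‖Y i G‖ ^ 2))
          ∂(stdGaussian (EuclideanSpace ℝ (Fin m × Fin d))) := by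
          refine lintegral_mono fun G => ?_
          simp_rw [← ENNReal.ofReal_mul (show (0 : ℝ) ≤ 1 / n by positivity)]
          rw [← ENNReal.ofReal_sum_of_nonneg fun i _ => by positivity]
          apply ENNReal.ofReal_le_ofReal
          -- Jensen replaces the exponential of the mean by the mean of exponentials, so no
          -- independence between the samples is needed.
          have := convexOn_exp.map_sum_le (t := Finset.univ) (w := fun _ : Fin n => 1 / (n : ℝ))
            (p := fun i => t * ‖Y i G‖ ^ 2) (fun _ _ => by positivity)
            (by simp [hn0.ne']) (fun _ _ => Set.mem_univ _)
          simp only [smul_eq_mul] at this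
          refine le_trans (le_of_eq ?_) this
          rw [Finset.mul_sum]
          congr 1
          exact Finset.sum_congr rfl fun i _ => by ring
      _ = ∑ i : Fin n, ENNReal.ofReal (1 / n) * ENNReal.ofReal ((√(1 - 2 * t))⁻¹ ^ m) := by
          rw [lintegral_finsetSum _ (fun i _ => by fun_prop)]
          refine Finset.sum_congr rfl fun i _ => ?_
          rw [lintegral_const_mul _ (by fun_prop), ← lintegral_exp_norm_sq_stdGaussian m ht1,
            ← map_rowVec_inner_stdGaussian (a := m) (hu i),
            lintegral_map (by fun_prop) (hYm i)]
      _ = ENNReal.ofReal ((√(1 - 2 * t))⁻¹ ^ m) := by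
          rw [← Finset.sum_mul, ← ENNReal.ofReal_sum_of_nonneg fun i _ => by positivity]
          simp [hn0.ne']
  rw [exp_neg_two_sqrt_log_sq hm, ← hlawG.map_eq, Measure.map_apply_of_aemeasurable
    hlawG.aemeasurable (measurableSet_lt measurable_const (by fun_prop))] at key
  refine (measure_mono fun ω hω => ?_).trans key
  simp only [Set.mem_preimage, Set.mem_ofPred_eq, hY] at hω ⊢
  have h1 : ∀ i, ‖(WithLp.toLp 2 fun k => ⟪rowVec (WithLp.toLp 2 fun k => X k ω / σ) k, u i⟫ :
      EuclideanSpace ℝ (Fin m))‖ ^ 2 =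
      (∑ k, ((Matrix.of fun i j => X (i, j) ω) *ᵥ (u i).ofLp) k ^ 2) / σ ^ 2 := by
    intro i
    rw [EuclideanSpace.real_norm_sq_eq, Finset.sum_div]
    refine Finset.sum_congr rfl fun k _ => ?_
    rw [← div_pow]
    congr 1
    simp only [inner_eq_sum_mul, Matrix.mulVec, dotProduct, Finset.sum_div, rowVec_apply,
      Matrix.of_apply]
    exact Finset.sum_congr rfl fun j _ => by ring
  simp_rw [h1]
  rw [← Finset.mul_sum, ← Finset.sum_div, ← mul_div_assoc, lt_div_iff₀ (by positivity)]
  rw [mul_pow] at hω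
  linarith

end GaussianWeights

/-! ### Forward bounds and parameter derivatives for general widths. -/

section Network

open scoped Matrix.Norms.L2Operator RealInnerProductSpace

theorem SmoothActivation.abs_le {φ : ℝ → ℝ} {β : ℝ} (hφ : SmoothActivation φ β) (t : ℝ) :
    |φ t| ≤ |t| + |φ 0| := by
  have h : |φ t - φ 0| ≤ 1 * |t - 0| :=
    Convex.norm_image_sub_le_of_norm_deriv_le (𝕜 := ℝ) (fun s _ => hφ.differentiable s)
      (fun s _ => hφ.abs_deriv_le s) convex_univ (Set.mem_univ 0) (Set.mem_univ t)
  rw [sub_zero, one_mul] at h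
  have := abs_sub_abs_le_abs_sub (φ t) (φ 0)
  linarith

theorem SmoothActivation.norm_map_le {φ : ℝ → ℝ} {β : ℝ} (hφ : SmoothActivation φ β) {k : ℕ}
    (z : Fin k → ℝ) :
    ‖(WithLp.toLp 2 fun i => φ (z i) : EuclideanSpace ℝ (Fin k))‖ ≤
      ‖(WithLp.toLp 2 z : EuclideanSpace ℝ (Fin k))‖ + √k * |φ 0| := by
  calc ‖(WithLp.toLp 2 fun i => φ (z i) : EuclideanSpace ℝ (Fin k))‖
      ≤ ‖(WithLp.toLp 2 fun i => |z i| : EuclideanSpace ℝ (Fin k)) +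
          WithLp.toLp 2 fun _ => |φ 0|‖ := by
        rw [← sq_le_sq₀ (norm_nonneg _) (norm_nonneg _), EuclideanSpace.real_norm_sq_eq,
          EuclideanSpace.real_norm_sq_eq]
        refine Finset.sum_le_sum fun i _ => ?_
        simp only [PiLp.add_apply]
        rw [sq_le_sq, abs_of_nonneg (by positivity : 0 ≤ |z i| + |φ 0|)]
        exact hφ.abs_le (z i)
    _ ≤ _ := norm_add_le _ _
    _ = _ := by
        congr 1
        · rw [← sq_eq_sq₀ (norm_nonneg _) (norm_nonneg _)]
          simp [EuclideanSpace.real_norm_sq_eq]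
        · rw [← sq_eq_sq₀ (norm_nonneg _) (by positivity)]
          simp [EuclideanSpace.real_norm_sq_eq, mul_pow]

variable {w : ℕ → ℕ} {L : ℕ} {φ : ℝ → ℝ} {β : ℝ}

theorem norm_weight_mulVec_le (θ : Param w L) (l : Fin L) (v : EuclideanSpace ℝ (Fin (w l))) :
    ‖(WithLp.toLp 2 (weight θ l *ᵥ v.ofLp) : EuclideanSpace ℝ (Fin (w (l + 1))))‖ ≤
      ‖weight θ l‖ * ‖v‖ :=
  Matrix.l2_opNorm_mulVec _ _

theorem norm_layer_succ_le (hφ : SmoothActivation φ β) (θ : Param w L)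
    (x : EuclideanSpace ℝ (Fin (w 0))) (l : ℕ) (h : l + 1 ≤ L) :
    ‖layer φ θ x (l + 1) h‖ ≤
      1 / √(w l : ℝ) * ‖(WithLp.toLp 2 (weight θ ⟨l, h⟩ *ᵥ
        (layer φ θ x l (Nat.le_of_succ_le h)).ofLp) : EuclideanSpace ℝ (Fin (w (l + 1))))‖ +
      √(w (l + 1) : ℝ) * |φ 0| := by
  rw [layer]
  refine (hφ.norm_map_le _).trans (le_of_eq ?_)
  congr 1
  nth_rw 2 [← Real.norm_of_nonneg (show 0 ≤ 1 / √(w l : ℝ) by positivity)]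
  rw [← norm_smul]
  rfl

/-- Squared Frobenius norm of the `k`-th weight matrix. -/
def weightFrobSq (η : Param w L) (l : Fin L) : ℝ :=
  ∑ i, ∑ j, weight η l i j ^ 2

theorem weightFrobSq_nonneg (η : Param w L) (l : Fin L) : 0 ≤ weightFrobSq η l := by
  unfold weightFrobSq; positivity

theorem norm_sq_eq_sum_weightFrobSq (η : Param w L) :
    ‖η‖ ^ 2 = ∑ l, weightFrobSq η l + ‖lastVec η‖ ^ 2 := by
  simp only [EuclideanSpace.real_norm_sq_eq, Fintype.sum_sum_type, Fintype.sum_sigma,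
    Fintype.sum_prod_type, weightFrobSq, weight, lastVec, Matrix.of_apply]

theorem norm_weight_mulVec_le_frob (η : Param w L) (l : Fin L)
    (v : EuclideanSpace ℝ (Fin (w l))) :
    ‖(WithLp.toLp 2 (weight η l *ᵥ v.ofLp) : EuclideanSpace ℝ (Fin (w (l + 1))))‖ ≤
      √(weightFrobSq η l) * ‖v‖ := by
  rw [← sq_le_sq₀ (norm_nonneg _) (by positivity), mul_pow, Real.sq_sqrt (weightFrobSq_nonneg _ _),
    EuclideanSpace.real_norm_sq_eq, EuclideanSpace.real_norm_sq_eq, weightFrobSq, Finset.sum_mul]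
  exact Finset.sum_le_sum fun i _ =>
    Finset.sum_mul_sq_le_sq_mul_sq Finset.univ (fun j => weight η l i j) fun j => v j

theorem hasFDerivAt_param (θ : Param w L) (k : ParamIdx w L) :
    HasFDerivAt (fun θ : Param w L => θ k) (EuclideanSpace.proj k : Param w L →L[ℝ] ℝ) θ :=
  (EuclideanSpace.proj k : Param w L →L[ℝ] ℝ).hasFDerivAt

/-- The product rule gives a term from varying the current matrix and one from varying the previous
layer; the factor `φ'` is dropped using `|φ'| ≤ 1`. The estimate stays per coordinate so that the
two terms can be summed as vectors before norms are taken. -/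
theorem hasFDerivAt_layer_succ_apply (hφ : SmoothActivation φ β) {θ : Param w L}
    {x : EuclideanSpace ℝ (Fin (w 0))} {l : ℕ} (h : l + 1 ≤ L)
    {D : Param w L →L[ℝ] EuclideanSpace ℝ (Fin (w l))}
    (hD : HasFDerivAt (fun θ => layer φ θ x l (Nat.le_of_succ_le h)) D θ)
    (i : Fin (w (l + 1))) :
    ∃ D' : Param w L →L[ℝ] ℝ, HasFDerivAt (fun θ => layer φ θ x (l + 1) h i) D' θ ∧
      ∀ η, |D' η| ≤ 1 / √(w l : ℝ) *
        |(weight η ⟨l, h⟩ *ᵥ (layer φ θ x l (Nat.le_of_succ_le h)).ofLp) i +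
          (weight θ ⟨l, h⟩ *ᵥ (D η).ofLp) i| := by
  have h1 : ∀ j, HasFDerivAt (fun θ => layer φ θ x l (Nat.le_of_succ_le h) j)
      ((EuclideanSpace.proj j : EuclideanSpace ℝ (Fin (w l)) →L[ℝ] ℝ).comp D) θ := fun j =>
    (EuclideanSpace.proj j : EuclideanSpace ℝ (Fin (w l)) →L[ℝ] ℝ).hasFDerivAt.comp θ hD
  have h2 := (HasFDerivAt.fun_sum (u := Finset.univ) fun j _ =>
    (hasFDerivAt_param θ (Sum.inl ⟨⟨l, h⟩, (i, j)⟩)).mul (h1 j)).const_mul (1 / √(w l : ℝ))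
  refine ⟨_, (hφ.differentiable _).hasDerivAt.comp_hasFDerivAt θ h2, fun η => ?_⟩
  simp only [_root_.smul_apply, smul_eq_mul, abs_mul]
  refine (mul_le_of_le_one_left (by positivity) (hφ.abs_deriv_le _)).trans (le_of_eq ?_)
  rw [abs_of_nonneg (show 0 ≤ 1 / √(w l : ℝ) by positivity)]
  congr 2
  simp only [_root_.sum_apply, _root_.add_apply,
    _root_.smul_apply, ContinuousLinearMap.comp_apply, PiLp.proj_apply, smul_eq_mul,
    Finset.sum_add_distrib, Matrix.mulVec, dotProduct, weight, Matrix.of_apply]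
  rw [add_comm]
  congr 1
  exact Finset.sum_congr rfl fun j _ => mul_comm _ _

theorem exists_hasFDerivAt_layer_succ (hφ : SmoothActivation φ β) {θ : Param w L}
    {x : EuclideanSpace ℝ (Fin (w 0))} {l : ℕ} (h : l + 1 ≤ L)
    {D : Param w L →L[ℝ] EuclideanSpace ℝ (Fin (w l))}
    (hD : HasFDerivAt (fun θ => layer φ θ x l (Nat.le_of_succ_le h)) D θ) :
    ∃ D' : Param w L →L[ℝ] EuclideanSpace ℝ (Fin (w (l + 1))),
      HasFDerivAt (fun θ => layer φ θ x (l + 1) h) D' θ ∧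
      ∀ η, ‖D' η‖ ≤ 1 / √(w l : ℝ) *
        (√(weightFrobSq η ⟨l, h⟩) * ‖layer φ θ x l (Nat.le_of_succ_le h)‖ +
          ‖weight θ ⟨l, h⟩‖ * ‖D η‖) := by
  choose D' hD' hb using hasFDerivAt_layer_succ_apply hφ h hD
  have hd : DifferentiableAt ℝ (fun θ => layer φ θ x (l + 1) h) θ :=
    differentiableAt_euclidean.2 fun i => (hD' i).differentiableAt
  refine ⟨_, hd.hasFDerivAt, fun η => ?_⟩
  have happ : ∀ i, fderiv ℝ (fun θ => layer φ θ x (l + 1) h) θ η i = D' i η := fun i =>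
    congrArg (fun T : Param w L →L[ℝ] ℝ => T η)
      (((EuclideanSpace.proj i : EuclideanSpace ℝ (Fin (w (l + 1))) →L[ℝ] ℝ).hasFDerivAt.comp θ
        hd.hasFDerivAt).unique (hD' i))
  calc _ ≤ ‖(1 / √(w l : ℝ)) • ((WithLp.toLp 2 (weight η ⟨l, h⟩ *ᵥ
          (layer φ θ x l (Nat.le_of_succ_le h)).ofLp) : EuclideanSpace ℝ (Fin (w (l + 1)))) +
          WithLp.toLp 2 (weight θ ⟨l, h⟩ *ᵥ (D η).ofLp))‖ := by
        rw [← sq_le_sq₀ (norm_nonneg _) (norm_nonneg _), EuclideanSpace.real_norm_sq_eq,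
          EuclideanSpace.real_norm_sq_eq]
        refine Finset.sum_le_sum fun i _ => ?_
        rw [happ, sq_le_sq]
        simp only [PiLp.smul_apply, PiLp.add_apply, smul_eq_mul, abs_mul]
        rw [abs_of_nonneg (show 0 ≤ 1 / √(w l : ℝ) by positivity)]
        exact hb i η
    _ ≤ _ := by
        rw [norm_smul, Real.norm_of_nonneg (show 0 ≤ 1 / √(w l : ℝ) by positivity)]
        gcongr
        exact (norm_add_le _ _).trans (add_le_add
          (norm_weight_mulVec_le_frob η ⟨l, h⟩ _) (norm_weight_mulVec_le θ ⟨l, h⟩ _))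

/-- Forward propagation of the parameter derivative. The first weight matrix does not need to be
bounded. -/
theorem exists_hasFDerivAt_layer (hφ : SmoothActivation φ β) {θ : Param w L}
    {x : EuclideanSpace ℝ (Fin (w 0))} {γ : ℝ} (hγ : 0 ≤ γ)
    (hW : ∀ l : Fin L, 1 ≤ l.val → 1 / √(w l : ℝ) * ‖weight θ l‖ ≤ γ) {a : ℕ → ℝ}
    (ha : ∀ l (h : l ≤ L), 1 / √(w l : ℝ) * ‖layer φ θ x l h‖ ≤ a l) :
    ∀ (l : ℕ) (h : l ≤ L), ∃ D : Param w L →L[ℝ] EuclideanSpace ℝ (Fin (w l)),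
      HasFDerivAt (fun θ => layer φ θ x l h) D θ ∧
      ∀ η, ‖D η‖ ≤ ∑ k : Fin l, γ ^ (l - 1 - k) * a k * √(weightFrobSq η (Fin.castLE h k)) := by
  intro l
  induction l with
  | zero =>
    intro h
    refine ⟨0, ?_, fun η => by simp⟩
    simp only [layer]
    exact hasFDerivAt_const _ _
  | succ l ih =>
    intro h
    obtain ⟨D, hD, hDb⟩ := ih (Nat.le_of_succ_le h)
    obtain ⟨D', hD', hb⟩ := exists_hasFDerivAt_layer_succ hφ h hD
    refine ⟨D', hD', fun η => (hb η).trans ?_⟩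
    have h1 : 1 / √(w l : ℝ) * (‖weight θ ⟨l, h⟩‖ * ‖D η‖) ≤ γ * ‖D η‖ := by
      rw [← mul_assoc]
      -- For `l = 0` the bound on `D η` is an empty sum, so the uncontrolled norm of the first
      -- matrix is multiplied by zero.
      rcases Nat.eq_zero_or_pos l with rfl | hl
      · have : ‖D η‖ = 0 := le_antisymm (by simpa using hDb η) (norm_nonneg _)
        simp [this]
      · gcongr
        exact hW ⟨l, h⟩ hl
    have h2 : 1 / √(w l : ℝ) * (√(weightFrobSq η ⟨l, h⟩) *
        ‖layer φ θ x l (Nat.le_of_succ_le h)‖) ≤ a l * √(weightFrobSq η ⟨l, h⟩) := by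
      calc _ = 1 / √(w l : ℝ) * ‖layer φ θ x l (Nat.le_of_succ_le h)‖ *
            √(weightFrobSq η ⟨l, h⟩) := by ring
        _ ≤ _ := by
            gcongr
            exact ha l _
    have h3 : γ * ‖D η‖ ≤ ∑ k : Fin l, γ ^ (l - k) * a k *
        √(weightFrobSq η (Fin.castLE (Nat.le_of_succ_le h) k)) := by
      refine (mul_le_mul_of_nonneg_left (hDb η) hγ).trans (le_of_eq ?_)
      rw [Finset.mul_sum]
      refine Finset.sum_congr rfl fun k _ => ?_
      have : l - k = (l - 1 - k) + 1 := by have := k.2; omega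
      rw [this, pow_succ]
      ring
    rw [Fin.sum_univ_castSucc, mul_add]
    simp only [Nat.add_sub_cancel, Fin.val_castSucc, Fin.val_last, Nat.sub_self, pow_zero, one_mul]
    rw [add_comm]
    exact add_le_add (h1.trans h3) h2

/-- Cauchy–Schwarz over `Option ι`, with `none` carrying the last-layer term. -/
theorem sum_mul_add_mul_sq_le {ι : Type*} [Fintype ι] (p e : ι → ℝ) (a v : ℝ) :
    (∑ k, p k * e k + a * v) ^ 2 ≤ (∑ k, p k ^ 2 + a ^ 2) * (∑ k, e k ^ 2 + v ^ 2) := by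
  have := Finset.sum_mul_sq_le_sq_mul_sq (Finset.univ : Finset (Option ι))
    (fun o => o.elim a p) (fun o => o.elim v e)
  simp only [Fintype.sum_option, Option.elim_none, Option.elim_some] at this
  rw [add_comm (a * v), add_comm (a ^ 2), add_comm (v ^ 2)] at this
  exact this

/-- Derivative of the network output. -/
theorem exists_hasFDerivAt_output (hφ : SmoothActivation φ β) {θ : Param w L}
    {x : EuclideanSpace ℝ (Fin (w 0))} {γ V : ℝ} (hγ : 0 ≤ γ)
    (hW : ∀ l : Fin L, 1 ≤ l.val → 1 / √(w l : ℝ) * ‖weight θ l‖ ≤ γ)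
    (hV : ‖lastVec θ‖ ≤ V) {a : ℕ → ℝ}
    (ha : ∀ l (h : l ≤ L), 1 / √(w l : ℝ) * ‖layer φ θ x l h‖ ≤ a l) :
    ∃ D : Param w L →L[ℝ] ℝ, HasFDerivAt (fun θ => output φ θ x) D θ ∧
      ∀ η, D η ^ 2 ≤ (1 / (w L : ℝ) * V ^ 2 * ∑ k : Fin L, a k ^ 2 * γ ^ (2 * (L - 1 - k)) +
        a L ^ 2) * ‖η‖ ^ 2 := by
  obtain ⟨D, hD, hDb⟩ := exists_hasFDerivAt_layer hφ hγ hW ha L le_rfl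
  have h1 : ∀ j, HasFDerivAt (fun θ => layer φ θ x L le_rfl j)
      ((EuclideanSpace.proj j : EuclideanSpace ℝ (Fin (w L)) →L[ℝ] ℝ).comp D) θ := fun j =>
    (EuclideanSpace.proj j : EuclideanSpace ℝ (Fin (w L)) →L[ℝ] ℝ).hasFDerivAt.comp θ hD
  have h2 := (HasFDerivAt.fun_sum (u := Finset.univ) fun j _ =>
    (hasFDerivAt_param θ (Sum.inr j)).mul (h1 j)).const_mul (1 / √(w L : ℝ))
  obtain ⟨T, hT, hTd⟩ : ∃ T, T = _ ∧ HasFDerivAt (fun θ => output φ θ x) T θ := ⟨_, rfl, h2⟩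
  refine ⟨T, hTd, fun η => ?_⟩
  have hV0 : 0 ≤ V := (norm_nonneg _).trans hV
  set S : ℝ := ∑ k : Fin L, γ ^ (L - 1 - k) * a k * √(weightFrobSq η k) with hS
  have hDS : ‖D η‖ ≤ S := hDb η
  have hval : T η = 1 / √(w L : ℝ) *
      (⟪lastVec θ, D η⟫ + ⟪lastVec η, layer φ θ x L le_rfl⟫) := by
    rw [hT]
    simp only [_root_.smul_apply, _root_.sum_apply,
      _root_.add_apply, ContinuousLinearMap.comp_apply, PiLp.proj_apply, smul_eq_mul,
      Finset.sum_add_distrib, inner_eq_sum_mul, lastVec]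
    congr 2
    exact Finset.sum_congr rfl fun j _ => mul_comm _ _
  have habs : |T η| ≤ ∑ k : Fin L, (1 / √(w L : ℝ) * V * (γ ^ (L - 1 - k) * a k)) *
      √(weightFrobSq η k) + a L * ‖lastVec η‖ := by
    rw [hval, abs_mul, abs_of_nonneg (show 0 ≤ 1 / √(w L : ℝ) by positivity)]
    calc _ ≤ 1 / √(w L : ℝ) * (‖lastVec θ‖ * ‖D η‖ + ‖lastVec η‖ * ‖layer φ θ x L le_rfl‖) := by
          gcongr
          exact (abs_add_le _ _).trans (add_le_add (abs_real_inner_le_norm _ _)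
            (abs_real_inner_le_norm _ _))
      _ ≤ 1 / √(w L : ℝ) * (V * S + ‖lastVec η‖ * ‖layer φ θ x L le_rfl‖) := by gcongr
      _ = 1 / √(w L : ℝ) * V * S +
          (1 / √(w L : ℝ) * ‖layer φ θ x L le_rfl‖) * ‖lastVec η‖ := by ring
      _ ≤ 1 / √(w L : ℝ) * V * S + a L * ‖lastVec η‖ := by
          gcongr
          exact ha L le_rfl
      _ = _ := by
          rw [hS, Finset.mul_sum]
          congr 1
          exact Finset.sum_congr rfl fun k _ => by ring
  calc (T η) ^ 2 = |T η| ^ 2 := (sq_abs _).symm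
    _ ≤ _ := pow_le_pow_left₀ (abs_nonneg _) habs 2
    _ ≤ _ := sum_mul_add_mul_sq_le _ _ _ _
    _ = _ := by
        rw [norm_sq_eq_sum_weightFrobSq]
        simp only [Real.sq_sqrt (weightFrobSq_nonneg _ _)]
        congr 2
        rw [Finset.mul_sum]
        refine Finset.sum_congr rfl fun k _ => ?_
        rw [mul_pow, mul_pow, mul_pow, div_pow, Real.sq_sqrt (Nat.cast_nonneg _), ← pow_mul]
        ring

theorem abs_output_le {θ : Param w L} {x : EuclideanSpace ℝ (Fin (w 0))} {V A : ℝ}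
    (hV : ‖lastVec θ‖ ≤ V) (hA : 1 / √(w L : ℝ) * ‖layer φ θ x L le_rfl‖ ≤ A) :
    |output φ θ x| ≤ V * A := by
  have hV0 : 0 ≤ V := (norm_nonneg _).trans hV
  have h : output φ θ x = 1 / √(w L : ℝ) * ⟪lastVec θ, layer φ θ x L le_rfl⟫ := by
    rw [inner_eq_sum_mul]; rfl
  rw [h, abs_mul, abs_of_nonneg (show 0 ≤ 1 / √(w L : ℝ) by positivity)]
  calc _ ≤ 1 / √(w L : ℝ) * (‖lastVec θ‖ * ‖layer φ θ x L le_rfl‖) := by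
        gcongr
        exact abs_real_inner_le_norm _ _
    _ = ‖lastVec θ‖ * (1 / √(w L : ℝ) * ‖layer φ θ x L le_rfl‖) := by ring
    _ ≤ V * A := by gcongr

/-- Gradient of the square loss, from a mean-square bound on the derivatives of the outputs. -/
theorem norm_gradient_sqLoss_le {n : ℕ} {x : Fin n → EuclideanSpace ℝ (Fin (w 0))}
    {y : Fin n → ℝ} {θ : Param w L} {C : Fin n → ℝ} {R : ℝ} (hR : 0 ≤ R)
    (hf : ∀ i, ∃ D : Param w L →L[ℝ] ℝ, HasFDerivAt (fun θ => output φ θ (x i)) D θ ∧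
      ∀ η, D η ^ 2 ≤ C i * ‖η‖ ^ 2)
    (hC : 1 / (n : ℝ) * ∑ i, C i ≤ R ^ 2) :
    ‖gradient (sqLoss φ x y) θ‖ ≤ 2 * √(sqLoss φ x y θ) * R := by
  choose D hD hDC using hf
  have h1 := (HasFDerivAt.fun_sum (u := Finset.univ) fun i _ =>
    ((hD i).const_sub (y i)).pow 2).const_mul (1 / (n : ℝ))
  obtain ⟨T, hT, hTd⟩ : ∃ T, T = _ ∧ HasFDerivAt (sqLoss φ x y) T θ := ⟨_, rfl, h1⟩
  -- The Riesz isometry turns the gradient norm into the operator norm of the derivative.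
  rw [gradient, LinearIsometryEquiv.norm_map, hTd.fderiv]
  refine ContinuousLinearMap.opNorm_le_bound _ (by positivity) fun η => ?_
  have hval : T η = -(2 * (1 / (n : ℝ) * ∑ i, (y i - output φ θ (x i)) * D i η)) := by
    rw [hT]
    simp only [_root_.smul_apply, _root_.sum_apply,
      _root_.neg_apply, smul_eq_mul]
    rw [Finset.mul_sum, Finset.mul_sum, Finset.mul_sum, ← Finset.sum_neg_distrib]
    exact Finset.sum_congr rfl fun i _ => by simp; ring
  have hloss : 0 ≤ sqLoss φ x y θ := by unfold sqLoss; positivity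
  rw [← sq_le_sq₀ (norm_nonneg _) (by positivity), Real.norm_eq_abs, sq_abs, hval, mul_pow, mul_pow,
    mul_pow, Real.sq_sqrt hloss, neg_sq, mul_pow, mul_pow]
  calc 2 ^ 2 * ((1 / (n : ℝ)) ^ 2 * (∑ i, (y i - output φ θ (x i)) * D i η) ^ 2)
      ≤ 2 ^ 2 * ((1 / (n : ℝ)) ^ 2 *
          ((∑ i, (y i - output φ θ (x i)) ^ 2) * ∑ i, D i η ^ 2)) := by
        gcongr
        exact Finset.sum_mul_sq_le_sq_mul_sq _ _ _
    _ ≤ 2 ^ 2 * ((1 / (n : ℝ)) ^ 2 *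
          ((∑ i, (y i - output φ θ (x i)) ^ 2) * ∑ i, C i * ‖η‖ ^ 2)) := by
        gcongr with i
        exact hDC i η
    _ = 2 ^ 2 * sqLoss φ x y θ * (1 / (n : ℝ) * ∑ i, C i) * ‖η‖ ^ 2 := by
        rw [← Finset.sum_mul, sqLoss]
        ring
    _ ≤ 2 ^ 2 * sqLoss φ x y θ * R ^ 2 * ‖η‖ ^ 2 := by gcongr

/-- Uses `(y - f)² ≤ 2 y² + 2 f²`, so again only the mean of the squared outputs has to be bounded.
-/
theorem sqLoss_le {n : ℕ} {x : Fin n → EuclideanSpace ℝ (Fin (w 0))}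
    {y : Fin n → ℝ} {θ : Param w L} {B : Fin n → ℝ} {R : ℝ}
    (hf : ∀ i, output φ θ (x i) ^ 2 ≤ B i) (hB : 1 / (n : ℝ) * ∑ i, B i ≤ R) :
    sqLoss φ x y θ ≤ 2 / (n : ℝ) * ∑ i, y i ^ 2 + 2 * R := by
  calc sqLoss φ x y θ ≤ 1 / (n : ℝ) * ∑ i, (2 * y i ^ 2 + 2 * B i) := by
        unfold sqLoss
        gcongr with i
        nlinarith [hf i, sq_nonneg (y i + output φ θ (x i))]
    _ = 2 / (n : ℝ) * ∑ i, y i ^ 2 + 2 * (1 / (n : ℝ) * ∑ i, B i) := by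
        rw [Finset.sum_add_distrib, ← Finset.mul_sum, ← Finset.mul_sum]
        ring
    _ ≤ _ := by gcongr

end Network

/-! ### Equal hidden widths: mean-square bounds and the good event. -/

section EqualWidth

open scoped Matrix.Norms.L2Operator

theorem sum_Icc_one_eq_sum_range (F : ℕ → ℝ) (n : ℕ) :
    ∑ i ∈ Finset.Icc 1 n, F i = ∑ i ∈ Finset.range n, F (i + 1) := by
  induction n with
  | zero => simp
  | succ n ih => rw [Finset.sum_Icc_succ_top (by omega), ih, Finset.sum_range_succ]

/-- Bound for the normalized norm of the `k`-th layer, when `u` bounds the normalized norm of the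
first preactivation. -/
def layerBound (φ : ℝ → ℝ) (γ u : ℝ) : ℕ → ℝ
  | 0 => 1
  | k + 1 => γ ^ k * u + |φ 0| * ∑ i ∈ Finset.Icc 1 (k + 1), γ ^ (i - 1)

theorem layerBound_succ_succ (φ : ℝ → ℝ) (γ u : ℝ) (k : ℕ) :
    layerBound φ γ u (k + 2) = γ * layerBound φ γ u (k + 1) + |φ 0| := by
  simp only [layerBound, sum_Icc_one_eq_sum_range, Nat.add_sub_cancel]
  rw [Finset.sum_range_succ' _ (k + 1)]
  simp only [pow_succ, ← Finset.sum_mul, pow_zero]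
  ring

/-- The first matrix enters only through its action on `x`, via `u`. Each later layer multiplies the
normalized norm by at most `γ` and adds `|φ 0|`, since the constant vector `|φ 0|` has norm `√m |φ
0|`. -/
theorem norm_layer_le_layerBound {d m L : ℕ} (hd : 1 ≤ d) (hm : 1 ≤ m) {φ : ℝ → ℝ} {β : ℝ}
    (hφ : SmoothActivation φ β) {θ : Param (width d m) L} {x : EuclideanSpace ℝ (Fin d)}
    (hx : ‖x‖ ^ 2 = d) {γ u : ℝ} (hγ : 0 ≤ γ)
    (hW : ∀ l : Fin L, 1 ≤ l.val → 1 / √(width d m l : ℝ) * ‖weight θ l‖ ≤ γ)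
    (hu : ∀ h : 0 < L, 1 / √(m : ℝ) * (1 / √(d : ℝ) * ‖(WithLp.toLp 2 (weight θ ⟨0, h⟩ *ᵥ x.ofLp) :
      EuclideanSpace ℝ (Fin m))‖) ≤ u) :
    ∀ (l : ℕ) (h : l ≤ L), 1 / √(width d m l : ℝ) * ‖layer φ θ x l h‖ ≤ layerBound φ γ u l := by
  have hd0 : 0 < √(d : ℝ) := Real.sqrt_pos.2 (by exact_mod_cast hd)
  have hm0 : 0 < √(m : ℝ) := Real.sqrt_pos.2 (by exact_mod_cast hm)
  intro l
  induction l with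
  | zero =>
    intro h
    have hxn : ‖x‖ = √(d : ℝ) := by rw [← hx, Real.sqrt_sq (norm_nonneg _)]
    change 1 / √(d : ℝ) * ‖x‖ ≤ 1
    rw [hxn, one_div_mul_cancel hd0.ne']
  | succ l ih =>
    intro h
    have hstep := norm_layer_succ_le hφ θ x l h
    have hmul := mul_le_mul_of_nonneg_left hstep (show 0 ≤ 1 / √(width d m (l + 1) : ℝ) by
      positivity)
    refine hmul.trans ?_
    have hcancel : 1 / √(width d m (l + 1) : ℝ) * (√(width d m (l + 1) : ℝ) * |φ 0|) = |φ 0| := by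
      rw [← mul_assoc, show width d m (l + 1) = m from rfl, one_div_mul_cancel hm0.ne', one_mul]
    rw [mul_add, hcancel]
    cases l with
    | zero =>
      have : layerBound φ γ u 1 = u + |φ 0| := by simp [layerBound]
      rw [this]
      exact add_le_add_left (hu h) _
    | succ k =>
      rw [layerBound_succ_succ]
      refine add_le_add_left ?_ _
      have ih' := ih (Nat.le_of_succ_le h)
      have hWk := hW ⟨k + 1, h⟩ (by simp)
      have hmv := norm_weight_mulVec_le θ ⟨k + 1, h⟩ (layer φ θ x (k + 1) (Nat.le_of_succ_le h))
      change 1 / √(m : ℝ) * _ ≤ _ at ih'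
      change 1 / √(m : ℝ) * _ ≤ _ at hWk
      change 1 / √(m : ℝ) * (1 / √(m : ℝ) * _) ≤ _
      calc _ ≤ 1 / √(m : ℝ) * (1 / √(m : ℝ) * (‖weight θ ⟨k + 1, h⟩‖ *
            ‖layer φ θ x (k + 1) (Nat.le_of_succ_le h)‖)) := by gcongr
        _ = (1 / √(m : ℝ) * ‖weight θ ⟨k + 1, h⟩‖) *
            (1 / √(m : ℝ) * ‖layer φ θ x (k + 1) (Nat.le_of_succ_le h)‖) := by ring
        _ ≤ γ * layerBound φ γ u (k + 1) := by
            gcongr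

/-- Minkowski's inequality for the mean square of `c u + K`. -/
theorem mean_sq_affine_le {n : ℕ} (hn : 1 ≤ n) {u : Fin n → ℝ} {c K U : ℝ} (hc : 0 ≤ c)
    (hK : 0 ≤ K) (hU : 0 ≤ U) (hu : 1 / (n : ℝ) * ∑ i, u i ^ 2 ≤ U ^ 2) :
    1 / (n : ℝ) * ∑ i, (c * u i + K) ^ 2 ≤ (c * U + K) ^ 2 := by
  have hn0 : (0 : ℝ) < n := by exact_mod_cast hn
  have h1 : (1 / (n : ℝ) * ∑ i, u i) ^ 2 ≤ U ^ 2 := by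
    refine le_trans ?_ hu
    have := sq_sum_le_card_mul_sum_sq (s := Finset.univ) (f := u)
    simp only [Finset.card_univ, Fintype.card_fin] at this
    calc (1 / (n : ℝ) * ∑ i, u i) ^ 2 = (1 / (n : ℝ)) ^ 2 * (∑ i, u i) ^ 2 := by ring
      _ ≤ (1 / (n : ℝ)) ^ 2 * (n * ∑ i, u i ^ 2) := by gcongr
      _ = _ := by field_simp
  have h2 : 1 / (n : ℝ) * ∑ i, u i ≤ U := le_of_abs_le (abs_le_of_sq_le_sq h1 hU)
  have h3 : 1 / (n : ℝ) * ∑ i, (c * u i + K) ^ 2 =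
      c ^ 2 * (1 / (n : ℝ) * ∑ i, u i ^ 2) + 2 * c * K * (1 / (n : ℝ) * ∑ i, u i) + K ^ 2 := by
    have : ∀ i, (c * u i + K) ^ 2 = c ^ 2 * u i ^ 2 + 2 * c * K * u i + K ^ 2 := fun i => by ring
    simp only [this, Finset.sum_add_distrib, ← Finset.mul_sum, Finset.sum_const, Finset.card_univ,
      Fintype.card_fin, nsmul_eq_mul]
    field_simp
  rw [h3]
  calc _ ≤ c ^ 2 * U ^ 2 + 2 * c * K * U + K ^ 2 := by gcongr
    _ = _ := by ring

/-- `layerBound` is affine in `u` with nonnegative coefficients, and at `u = γ` it equals `hFun`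
with index shifted by one. -/
theorem mean_layerBound_sq_le {n : ℕ} (hn : 1 ≤ n) {φ : ℝ → ℝ} {γ : ℝ} (hγ : 0 ≤ γ)
    {u : Fin n → ℝ} (hu : 1 / (n : ℝ) * ∑ i, u i ^ 2 ≤ γ ^ 2) (k : ℕ) :
    1 / (n : ℝ) * ∑ i, layerBound φ γ (u i) k ^ 2 ≤ hFun φ γ (k + 1) ^ 2 := by
  have hn0 : (0 : ℝ) < n := by exact_mod_cast hn
  cases k with
  | zero => simp [layerBound, hFun, hn0.ne']
  | succ k =>
    simp only [layerBound, hFun, Nat.add_sub_cancel]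
    rw [pow_succ γ k]
    exact mean_sq_affine_le hn (by positivity) (by positivity) hγ hu

theorem rhoBound_sq {φ : ℝ → ℝ} {m L : ℕ} {γ ρ₁ : ℝ} (hγ : 0 ≤ γ) :
    rhoBound φ m L γ ρ₁ ^ 2 = 1 / (m : ℝ) * (1 + ρ₁) ^ 2 *
      ∑ k : Fin L, hFun φ γ (k + 1) ^ 2 * γ ^ (2 * (L - 1 - k)) + hFun φ γ (L + 1) ^ 2 := by
  rw [rhoBound, Real.sq_sqrt (by positivity), add_comm, sum_Icc_one_eq_sum_range,
    Finset.sum_range]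
  congr 2
  refine Finset.sum_congr rfl fun k _ => ?_
  rw [Nat.sub_sub, add_comm 1]

/-- The loss and gradient bounds on the spectral ball around a well-behaved initialization. -/
theorem gradient_bound_of_init {d m L n : ℕ} (hd : 1 ≤ d) (hm : 1 ≤ m) (hL : 0 < L) (hn : 1 ≤ n)
    {φ : ℝ → ℝ} {β : ℝ} (hφ : SmoothActivation φ β) {σ₁ ρ ρ₁ : ℝ} (hσ₁ : 0 ≤ σ₁) (hρ : 0 ≤ ρ)
    (hρ₁ : 0 ≤ ρ₁) {x : Fin n → EuclideanSpace ℝ (Fin d)} (hx : ∀ i, ‖x i‖ ^ 2 = (d : ℝ))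
    (y : Fin n → ℝ) {θ₀ θ : Param (width d m) L}
    (hW₀ : ∀ l : Fin L, 1 ≤ l.val → ‖weight θ₀ l‖ ≤ σ₁ * √m)
    (hx₀ : 1 / (n : ℝ) * ∑ i, (1 / √(m : ℝ) * (1 / √(d : ℝ) *
      ‖(WithLp.toLp 2 (weight θ₀ ⟨0, hL⟩ *ᵥ (x i).ofLp) : EuclideanSpace ℝ (Fin m))‖)) ^ 2 ≤
        σ₁ ^ 2)
    (hv₀ : ‖lastVec θ₀‖ = 1) (hθ : θ ∈ specBall ρ ρ₁ θ₀) :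
    ‖gradient (sqLoss φ x y) θ‖ ≤
        2 * √(sqLoss φ x y θ) * rhoBound φ m L (gam m σ₁ ρ) ρ₁ ∧
      sqLoss φ x y θ ≤ lossBound φ L y ρ₁ (gam m σ₁ ρ) := by
  have hm0 : 0 < √(m : ℝ) := Real.sqrt_pos.2 (by exact_mod_cast hm)
  have hd0 : 0 < √(d : ℝ) := Real.sqrt_pos.2 (by exact_mod_cast hd)
  obtain ⟨L, rfl⟩ : ∃ K, L = K + 1 := ⟨L - 1, by omega⟩
  obtain ⟨hθW, hθv⟩ := hθ
  set γ : ℝ := gam m σ₁ ρ with hγdef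
  have hγ : 0 ≤ γ := by rw [hγdef, gam]; positivity
  have hV : ‖lastVec θ‖ ≤ 1 + ρ₁ := by
    have := norm_sub_norm_le (lastVec θ) (lastVec θ₀)
    linarith
  have hW : ∀ l : Fin (L + 1), 1 ≤ l.val → 1 / √(width d m l : ℝ) * ‖weight θ l‖ ≤ γ := by
    intro l hl
    have hw : √(width d m l : ℝ) = √m := by
      obtain ⟨k, hk⟩ : ∃ k, l.val = k + 1 := ⟨l.val - 1, by omega⟩
      rw [hk]; rfl
    rw [hw]
    have h1 := norm_sub_norm_le (weight θ l) (weight θ₀ l)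
    have h2 : ‖weight θ l‖ ≤ σ₁ * √m + ρ := by linarith [hW₀ l hl, hθW l]
    rw [one_div_mul_eq_div, div_le_iff₀ hm0, hγdef, gam, add_mul, div_mul_cancel₀ _ hm0.ne']
    exact h2
  set q : Fin n → ℝ := fun i => 1 / √(m : ℝ) * (1 / √(d : ℝ) *
    ‖(WithLp.toLp 2 (weight θ₀ ⟨0, hL⟩ *ᵥ (x i).ofLp) : EuclideanSpace ℝ (Fin m))‖) with hq
  -- Moving the first matrix by `ρ` in operator norm moves `W x` by at most `ρ √d`, that is `ρ / √m`
  -- after normalization. The factor `1 *` fits the affine form of `mean_sq_affine_le`.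
  set u : Fin n → ℝ := fun i => 1 * q i + ρ / √m with hu
  have hu2 : 1 / (n : ℝ) * ∑ i, u i ^ 2 ≤ γ ^ 2 := by
    have := mean_sq_affine_le hn zero_le_one (show 0 ≤ ρ / √(m : ℝ) by positivity) hσ₁ hx₀
    rwa [one_mul] at this
  have hub : ∀ i, ∀ h : 0 < L + 1, 1 / √(m : ℝ) * (1 / √(d : ℝ) *
      ‖(WithLp.toLp 2 (weight θ ⟨0, h⟩ *ᵥ (x i).ofLp) : EuclideanSpace ℝ (Fin m))‖) ≤ u i := by
    intro i h
    have hxn : ‖x i‖ = √(d : ℝ) := by rw [← hx i, Real.sqrt_sq (norm_nonneg _)]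
    have hsplit : (WithLp.toLp 2 (weight θ ⟨0, h⟩ *ᵥ (x i).ofLp) : EuclideanSpace ℝ (Fin m)) =
        WithLp.toLp 2 (weight θ₀ ⟨0, h⟩ *ᵥ (x i).ofLp) +
          WithLp.toLp 2 ((weight θ ⟨0, h⟩ - weight θ₀ ⟨0, h⟩) *ᵥ (x i).ofLp) := by
      rw [← WithLp.toLp_add]
      congr 1
      erw [← Matrix.add_mulVec]
      rw [add_sub_cancel]
      rfl
    have hmv : ‖(WithLp.toLp 2 ((weight θ ⟨0, h⟩ - weight θ₀ ⟨0, h⟩) *ᵥ (x i).ofLp) :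
        EuclideanSpace ℝ (Fin m))‖ ≤ ρ * √d := by
      refine (Matrix.l2_opNorm_mulVec _ (x i)).trans ?_
      rw [hxn]
      exact mul_le_mul_of_nonneg_right (hθW ⟨0, h⟩) hd0.le
    have hle := (norm_add_le (WithLp.toLp 2 (weight θ₀ ⟨0, h⟩ *ᵥ (x i).ofLp) :
      EuclideanSpace ℝ (Fin m)) (WithLp.toLp 2
        ((weight θ ⟨0, h⟩ - weight θ₀ ⟨0, h⟩) *ᵥ (x i).ofLp))).trans (add_le_add_right hmv _)
    rw [hsplit]
    calc _ ≤ 1 / √(m : ℝ) * (1 / √(d : ℝ) * (‖(WithLp.toLp 2 (weight θ₀ ⟨0, h⟩ *ᵥ (x i).ofLp) :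
          EuclideanSpace ℝ (Fin m))‖ + ρ * √d)) := by
          gcongr
          exact hle
      _ = u i := by
          simp only [hu, hq]
          field_simp
  have hl := fun i => norm_layer_le_layerBound hd hm hφ (hx i) hγ hW (hub i)
  have hmean := mean_layerBound_sq_le (φ := φ) hn hγ hu2
  constructor
  · refine norm_gradient_sqLoss_le (Real.sqrt_nonneg _)
      (fun i => exists_hasFDerivAt_output hφ hγ hW hV (hl i)) ?_
    rw [rhoBound_sq hγ, Finset.sum_add_distrib, mul_add]
    refine add_le_add ?_ (hmean (L + 1))
    -- Exchanging the sums over samples and layers lets the mean-square bound be applied layer by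
    -- layer.
    rw [← Finset.mul_sum, Finset.sum_comm, mul_left_comm]
    change 1 / (m : ℝ) * _ * _ ≤ _
    gcongr 1 / (m : ℝ) * (1 + ρ₁) ^ 2 * ?_
    rw [Finset.mul_sum]
    refine Finset.sum_le_sum fun k _ => ?_
    rw [← Finset.sum_mul, ← mul_assoc]
    gcongr
    exact hmean k
  · have hout : ∀ i, output φ θ (x i) ^ 2 ≤
        (1 + ρ₁) ^ 2 * layerBound φ γ (u i) (L + 1) ^ 2 := by
      intro i
      have := abs_output_le hV (hl i (L + 1) le_rfl)
      rw [← sq_abs, ← mul_pow]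
      exact pow_le_pow_left₀ (abs_nonneg _) this 2
    have hB : 1 / (n : ℝ) * ∑ i, (1 + ρ₁) ^ 2 * layerBound φ γ (u i) (L + 1) ^ 2 ≤
        (1 + ρ₁) ^ 2 * |gFun φ (L + 1) γ| ^ 2 := by
      rw [← Finset.mul_sum, mul_left_comm, sq_abs]
      gcongr
      exact hmean (L + 1)
    refine (sqLoss_le hout hB).trans (le_of_eq ?_)
    rw [lossBound]
    ring

/-! ### Probability of a good initialization. -/

/-- With high probability the initialization is well-behaved. -/
theorem IsRandomInit.measure_bad_le {Ω : Type*} [MeasurableSpace Ω] {μ : Measure Ω}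
    [IsProbabilityMeasure μ] {d m L n : ℕ} (hd : 1 ≤ d) (hm : 1 ≤ m) (hL : 0 < L) (hn : 1 ≤ n)
    {σ₁ : ℝ} (hσ₁ : 0 < σ₁) {x : Fin n → EuclideanSpace ℝ (Fin d)}
    (hx : ∀ i, ‖x i‖ ^ 2 = (d : ℝ)) {θ₀ : Ω → Param (width d m) L} (hθ₀ : IsRandomInit μ σ₁ θ₀) :
    μ {ω | ¬ ((∀ l : Fin L, 1 ≤ l.val → ‖weight (θ₀ ω) l‖ ≤ σ₁ * √m) ∧
      1 / (n : ℝ) * ∑ i, (1 / √(m : ℝ) * (1 / √(d : ℝ) *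
        ‖(WithLp.toLp 2 (weight (θ₀ ω) ⟨0, hL⟩ *ᵥ (x i).ofLp) : EuclideanSpace ℝ (Fin m))‖)) ^ 2 ≤
          σ₁ ^ 2 ∧ ‖lastVec (θ₀ ω)‖ = 1)} ≤ ENNReal.ofReal (2 * ((L : ℝ) + 1) / m) := by
  have hm1 : (1 : ℝ) ≤ m := by exact_mod_cast hm
  have hm0 : (0 : ℝ) < m := by linarith
  have hms : 0 < √(m : ℝ) := Real.sqrt_pos.2 hm0
  have hd0 : 0 < √(d : ℝ) := Real.sqrt_pos.2 (by exact_mod_cast hd)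
  have hσ : 0 < initStd m σ₁ := by rw [initStd]; positivity
  have hscale : initStd m σ₁ * (2 * (√m + 2 * √(Real.log m))) = σ₁ * √m := by
    rw [initStd]
    have : 0 < 1 + 2 * √(Real.log m) / √(m : ℝ) := by positivity
    field_simp
  have hind : ∀ l : Fin L, iIndepFun (fun (p : Fin (width d m (l + 1)) × Fin (width d m l)) ω =>
      θ₀ ω (Sum.inl ⟨l, p⟩)) μ := fun l =>
    hθ₀.indep.precomp (g := fun p => (⟨l, p⟩ : WeightIdx (width d m) L)) fun p q h => by
      simpa using h
  set A : Set Ω := {ω | (initStd m σ₁ * (√m + 2 * √(Real.log m))) ^ 2 <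
        1 / (n : ℝ) * ∑ i, ∑ k : Fin m,
          (weight (θ₀ ω) ⟨0, hL⟩ *ᵥ ((1 / √(d : ℝ)) • x i).ofLp) k ^ 2} with hA
  have hAm : μ A ≤ ENNReal.ofReal (1 / m ^ 2) := by
    refine measure_lt_mean_norm_sq_le (m := m) (d := d) hm hn hσ (hind ⟨0, hL⟩)
      (fun p => hθ₀.gaussian _) (u := fun i => (1 / √(d : ℝ)) • x i) fun i => ?_
    have hxn : ‖x i‖ = √(d : ℝ) := by rw [← hx i, Real.sqrt_sq (norm_nonneg _)]
    rw [norm_smul, hxn, Real.norm_of_nonneg (by positivity), one_div_mul_cancel hd0.ne']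
  -- The condition `1 ≤ l` makes the event for the first matrix empty; `A` handles that matrix.
  set B : Fin L → Set Ω := fun l => {ω | 1 ≤ l.val ∧ σ₁ * √m < ‖weight (θ₀ ω) l‖} with hB
  have hBm : ∀ l, μ (B l) ≤ ENNReal.ofReal (2 / m) := by
    intro l
    by_cases hl : 1 ≤ l.val
    · have hw : width d m l ≤ m := by
        obtain ⟨k, hk⟩ : ∃ k, l.val = k + 1 := ⟨l.val - 1, by omega⟩
        rw [hk]; rfl
      refine (measure_mono fun ω hω => ?_).trans (measure_lt_opNorm_le (a := width d m (l + 1))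
        (b := width d m l) hm le_rfl hw hσ (hind l) fun p => hθ₀.gaussian _)
      simp only [Set.mem_ofPred_eq, hscale]
      exact hω.2
    · simp [hB, hl]
  have hN : μ {ω | ¬ ‖lastVec (θ₀ ω)‖ = 1} = 0 := hθ₀.norm_lastVec
  calc _ ≤ μ (A ∪ ((⋃ l, B l) ∪ {ω | ¬ ‖lastVec (θ₀ ω)‖ = 1})) := by
        refine measure_mono fun ω hω => ?_
        by_contra hcon
        simp only [Set.mem_union, Set.mem_iUnion, Set.mem_ofPred_eq, not_or, not_exists, not_not,
          hA, hB, not_and, not_lt] at hcon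
        obtain ⟨h1, h2, h3⟩ := hcon
        refine hω ⟨h2, ?_, h3⟩
        have hterm : ∀ i, (1 / √(m : ℝ) * (1 / √(d : ℝ) * ‖(WithLp.toLp 2
            (weight (θ₀ ω) ⟨0, hL⟩ *ᵥ (x i).ofLp) : EuclideanSpace ℝ (Fin m))‖)) ^ 2 =
            1 / (m : ℝ) * ∑ k : Fin m,
              (weight (θ₀ ω) ⟨0, hL⟩ *ᵥ ((1 / √(d : ℝ)) • x i).ofLp) k ^ 2 := by
          intro i
          rw [mul_pow, div_pow, Real.sq_sqrt hm0.le, one_pow, mul_pow,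
            EuclideanSpace.real_norm_sq_eq, Finset.mul_sum]
          congr 1
          refine Finset.sum_congr rfl fun k _ => ?_
          rw [← mul_pow, WithLp.ofLp_smul]
          erw [Matrix.mulVec_smul]
          rfl
        simp_rw [hterm]
        rw [← Finset.mul_sum, mul_left_comm]
        -- This threshold lacks the factor `2` of the operator norm bound, so the mean square is
        -- even at most `σ₁² / 4`.
        calc _ ≤ 1 / (m : ℝ) * (initStd m σ₁ * (√m + 2 * √(Real.log m))) ^ 2 := by gcongr
          _ = 1 / (m : ℝ) * (σ₁ * √m / 2) ^ 2 := by rw [← hscale]; ring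
          _ = σ₁ ^ 2 / 4 := by
              rw [div_pow, mul_pow, Real.sq_sqrt hm0.le]
              field_simp
              norm_num
          _ ≤ σ₁ ^ 2 := by nlinarith
    _ ≤ μ A + (∑ l, μ (B l) + 0) := by
        refine (measure_union_le _ _).trans (add_le_add le_rfl ((measure_union_le _ _).trans ?_))
        exact add_le_add (measure_iUnion_fintype_le μ B) hN.le
    _ ≤ ENNReal.ofReal (1 / m ^ 2) + (∑ _l : Fin L, ENNReal.ofReal (2 / m) + 0) := by
        gcongr with l
        exact hBm l
    _ = ENNReal.ofReal (1 / m ^ 2 + L * (2 / m)) := by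
        rw [add_zero, Finset.sum_const, Finset.card_univ, Fintype.card_fin, nsmul_eq_mul,
          ENNReal.ofReal_add (by positivity) (by positivity),
          ENNReal.ofReal_mul (Nat.cast_nonneg _), ENNReal.ofReal_natCast]
    _ ≤ _ := by
        apply ENNReal.ofReal_le_ofReal
        have : 1 / (m : ℝ) ^ 2 ≤ 2 / m := by
          rw [div_le_div_iff₀ (by positivity) hm0]
          nlinarith
        have h2 : 2 * ((L : ℝ) + 1) / m = 2 / m + L * (2 / m) := by ring
        linarith

/-- The good event quantifies over data-dependent conditions and `θ₀` is not assumed measurable as a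
whole, so the complement of a measurable hull of the bad event is used. -/
theorem exists_measurableSet_of_measure_not_le {Ω : Type*} [MeasurableSpace Ω] {μ : Measure Ω}
    [IsProbabilityMeasure μ] {P : Ω → Prop} {p : ℝ} (hp : 0 ≤ p)
    (h : μ {ω | ¬ P ω} ≤ ENNReal.ofReal p) :
    ∃ E, MeasurableSet E ∧ 1 - p ≤ μ.real E ∧ ∀ ω ∈ E, P ω := by
  refine ⟨(toMeasurable μ {ω | ¬ P ω})ᶜ, (measurableSet_toMeasurable _ _).compl, ?_,
    fun ω hω => not_not.1 fun hP => hω (subset_toMeasurable μ _ hP)⟩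
  rw [← measure_toMeasurable] at h
  rw [probReal_compl_eq_one_sub (measurableSet_toMeasurable _ _)]
  exact sub_le_sub_left (ENNReal.toReal_le_of_le_ofReal hp h) 1

end EqualWidth

end DeepNet

/-! ### The loss gradient bound. -/

theorem mainTheorem11 {Ω : Type*} [MeasurableSpace Ω] (μ : Measure Ω) [IsProbabilityMeasure μ]
    (d m L n : ℕ) (hd : 1 ≤ d) (hm : 1 ≤ m) (hL : 1 ≤ L) (hn : 1 ≤ n)
    (φ : ℝ → ℝ) (β : ℝ) (hφ : DeepNet.SmoothActivation φ β)
    (σ₁ ρ ρ₁ : ℝ) (hσ₁ : 0 < σ₁) (hρ : 0 ≤ ρ) (hρ₁ : 0 ≤ ρ₁)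
    (x : Fin n → EuclideanSpace ℝ (Fin d)) (hx : ∀ i, ‖x i‖ ^ 2 = (d : ℝ))
    (y : Fin n → ℝ)
    (θ₀ : Ω → DeepNet.Param (DeepNet.width d m) L) (hθ₀ : DeepNet.IsRandomInit μ σ₁ θ₀) :
    ∃ E : Set Ω, MeasurableSet E ∧ 1 - 2 * ((L : ℝ) + 1) / (m : ℝ) ≤ μ.real E ∧
      ∀ ω ∈ E, ∀ θ ∈ DeepNet.specBall ρ ρ₁ (θ₀ ω),
        ‖gradient (DeepNet.sqLoss φ x y) θ‖ ≤
            2 * √(DeepNet.sqLoss φ x y θ) *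
              DeepNet.rhoBound φ m L (DeepNet.gam m σ₁ ρ) ρ₁ ∧
          2 * √(DeepNet.sqLoss φ x y θ) *
              DeepNet.rhoBound φ m L (DeepNet.gam m σ₁ ρ) ρ₁ ≤
            2 * √(DeepNet.lossBound φ L y ρ₁ (DeepNet.gam m σ₁ ρ)) *
              DeepNet.rhoBound φ m L (DeepNet.gam m σ₁ ρ) ρ₁ := by
  obtain ⟨E, hE, hp, hgood⟩ := DeepNet.exists_measurableSet_of_measure_not_le (by positivity)
    (hθ₀.measure_bad_le hd hm hL hn hσ₁ hx)
  refine ⟨E, hE, hp, fun ω hω θ hθ => ?_⟩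
  obtain ⟨hW₀, hx₀, hv₀⟩ := hgood ω hω
  obtain ⟨h1, h2⟩ :=
    DeepNet.gradient_bound_of_init hd hm hL hn hφ hσ₁.le hρ hρ₁ hx y hW₀ hx₀ hv₀ hθ
  refine ⟨h1, ?_⟩
  have h0 : 0 ≤ DeepNet.rhoBound φ m L (DeepNet.gam m σ₁ ρ) ρ₁ := Real.sqrt_nonneg _
  gcongr
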